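/- Let $(Q,N,C_1,C_2,\dots)$ be a random vector with $Q$ and all $C_i$ real valued and $N\in\{0,1,2,\dots\}$, and for $\gamma>0$ put $\rho_\gamma=E\big[\sum_{i=1}^N|C_i|^\gamma\big]$. *The process $R^{(k)}$.* Let $U=\bigcup_{n\ge0}\{1,2,\dots\}^n$ be the set of finite sequences of positive integers, with the empty sequence $\emptyset$, and let $\{(Q_{\mathbf i},N_{\mathbf i},C_{(\mathbf i,1)},C_{(\mathbf i,2)},\dots)\}_{\mathbf i\in U}$ be i.i.d. copies of $(Q,N,C_1,C_2,\dots)$. Put $A_0=\{\emptyset\}$, $A_n=\{(\mathbf i,r):\mathbf i\in A_{n-1},\,1\le r\le N_{\mathbf i}\}$ for $n\ge1$, $\Pi_\emptyset=1$, $\Pi_{(\mathbf i,r)}=C_{(\mathbf i,r)}\Pi_{\mathbf i}$, and $$R^{(k)}=\sum_{j=0}^k\sum_{\mathbf i\in A_j}Q_{\mathbf i}\Pi_{\mathbf i},\qquad k\ge0.$$ Let $F_k$ be the law of $R^{(k)}$. *The iterative bootstrap algorithm.* Fix a pool size $m\ge1$. Let $\hat R^{(0,m)}_1,\dots,\hat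 R^{(0,m)}_m$ be i.i.d. copies of $Q$. For $j\ge1$, given the pool $(\hat R^{(j-1,m)}_1,\dots,\hat R^{(j-1,m)}_m)$, take i.i.d. copies $(Q_i,N_i,C_{(i,1)},C_{(i,2)},\dots)$, $1\le i\le m$, of $(Q,N,C_1,C_2,\dots)$, independent of everything else, and put $$\hat R^{(j,m)}_i=\sum_{r=1}^{N_i}C_{(i,r)}\hat R^{(j-1,m)}_{(i,r)}+Q_i,\qquad 1\le i\le m,$$ where the $\hat R^{(j-1,m)}_{(i,r)}$ are drawn independently and uniformly with replacement from the pool at level $j-1$ (that is, they are its members at independent uniform positions, independent of everything else). Let $\hat F_{k,m}=\frac1m\sum_{i=1}^m\delta_{\hat R^{(k,m)}_i}$ be the empirical distribution of the pool at level $k$. *Distance.* For probability measures $\mu,\nu$ on $\mathbb R$ let $d_1(\mu,\nu)=\inf_\pi\int_{\mathbb R\times\mathbb R}|x-y|\,d\pi(x,y)$, the infimum over all probability measures $\pi$ on $\mathbb R\times\mathbb R$ with marginals $\mu$ and $\nu$ (the Kantorovich–Rubinstein or Wasserstein-1 distance). **Theorem.** Let $\beta>1$ be such that $E[|Q|^\beta]<\infty$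 and $E\big[\big(\sum_{i=1}^N|C_i|\big)^\beta\big]<\infty$, and assume that either (i) $\max(\rho_1,\rho_\beta)<1$, or (ii) $\beta=2$, $\rho_1=1$, $\rho_\beta<1$ and $E[Q]=0$. Then for every $\alpha\in(1,2)$ with $\alpha\le\beta$ there is a constant $K_\alpha<\infty$, depending on $\alpha$ and the law of $(Q,N,C_1,C_2,\dots)$ but not on $k$ or $m$, such that for all $k\ge0$ and $m\ge1$ $$E\big[d_1(\hat F_{k,m},F_k)\big]\le K_\alpha\,m^{-1+1/\alpha}\sum_{i=0}^k\rho_1^i.$$ -/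

import Mathlib

open MeasureTheory ProbabilityTheory
open scoped ENNReal

noncomputable section

namespace IterBootstrap

/-- The value space of a branching vector `(Q, N, C₁, C₂, …)`, with the weights `C_{r+1}`
stored at position `r`, so that `∑_{r=1}^N` becomes a sum over `Finset.range N`. -/
abbrev BranchVec : Type := ℝ × ℕ × (ℕ → ℝ)

/-- The `Q` component. -/
def BranchVec.Q (v : BranchVec) : ℝ := v.1

/-- The `N` component. -/
def BranchVec.N (v : BranchVec) : ℕ := v.2.1

/-- The weights. -/
def BranchVec.C (v : BranchVec) (r : ℕ) : ℝ := v.2.2 r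

/-- `ρ_β = E[∑_{i=1}^N |C_i|^β]`, where `μ` is the law of the generic branching vector. -/
def rho (μ : Measure BranchVec) (β : ℝ) : ℝ :=
  ∫ v, ∑ i ∈ Finset.range (BranchVec.N v), |BranchVec.C v i| ^ β ∂μ

/-- The moment conditions on the generic branching vector with law `μ`. -/
structure MomentConditions (μ : Measure BranchVec) (β : ℝ) : Prop where
  one_le : 1 ≤ β
  moment_Q : Integrable (fun v => |BranchVec.Q v| ^ β) μ
  moment_C : Integrable
    (fun v => (∑ i ∈ Finset.range (BranchVec.N v), |BranchVec.C v i|) ^ β) μ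
  contraction : max (rho μ 1) (rho μ β) < 1 ∨
    (β = 2 ∧ rho μ 1 = 1 ∧ rho μ β < 1 ∧ ∫ v, BranchVec.Q v ∂μ = 0)

section WeightedBranching

variable {Ω : Type*}

/-- `V` is an i.i.d. family of copies of the generic branching vector, indexed by the nodes of
the infinite tree `U`. A node `(i₁, …, iₙ)` is the list `[iₙ, …, i₁]`, so that the child
`(𝐢, r)` of the node `𝐢` is `r :: 𝐢`; children are numbered from `0`. -/
structure IsBranchingFamily [MeasurableSpace Ω] (μ : Measure BranchVec) (P : Measure Ω)
    (V : List ℕ → Ω → BranchVec) : Prop where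
  measurable : ∀ i, Measurable (V i)
  law : ∀ i, P.map (V i) = μ
  indep : iIndepFun V P

/-- The `n`th generation `A_n` of the tree. -/
def generation (V : List ℕ → Ω → BranchVec) (ω : Ω) : ℕ → Finset (List ℕ)
  | 0 => {[]}
  | n + 1 => (generation V ω n).biUnion fun i =>
      (Finset.range (BranchVec.N (V i ω))).image fun r => r :: i

/-- The weight `Π_𝐢` of a node: `Π_∅ = 1`, `Π_{(𝐢, r)} = C_{(𝐢, r)} Π_𝐢`. -/
def weight (V : List ℕ → Ω → BranchVec) (ω : Ω) : List ℕ → ℝ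
  | [] => 1
  | r :: i => BranchVec.C (V i ω) r * weight V ω i

/-- `R^{(k)} = ∑_{j=0}^k ∑_{𝐢 ∈ A_j} Q_𝐢 Π_𝐢`. -/
def R (V : List ℕ → Ω → BranchVec) (k : ℕ) (ω : Ω) : ℝ :=
  ∑ j ∈ Finset.range (k + 1), ∑ i ∈ generation V ω j, BranchVec.Q (V i ω) * weight V ω i

end WeightedBranching

section Algorithm

variable {Ω : Type*} {m : ℕ}

/-- The randomness consumed by the algorithm with pool size `m`:
* `Q₀ i`, for the initial pool, are copies of `Q`;
* `V j i` is the branching vector used for member `i` of the pool at level `j + 1`;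
* `I j i r` is the position, uniform among `0, …, m - 1`, of the member of the level-`j` pool
  that is drawn as the `r`th summand of member `i` of the pool at level `j + 1`.

All of these random elements are jointly independent. -/
structure IsAlgorithmInput [MeasurableSpace Ω] (μ : Measure BranchVec) (P : Measure Ω)
    (Q₀ : Fin m → Ω → ℝ) (V : ℕ → Fin m → Ω → BranchVec)
    (I : ℕ → Fin m → ℕ → Ω → Fin m) : Prop where
  measurable_Q₀ : ∀ i, Measurable (Q₀ i)
  measurable_V : ∀ j i, Measurable (V j i)
  measurable_I : ∀ j i r, Measurable (I j i r)
  law_Q₀ : ∀ i, P.map (Q₀ i) = μ.map BranchVec.Q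
  law_V : ∀ j i, P.map (V j i) = μ
  law_I : ∀ j i r, P.map (I j i r) = uniformOn Set.univ
  indep_Q₀ : iIndepFun Q₀ P
  indep_V : iIndepFun (fun p : ℕ × Fin m => V p.1 p.2) P
  indep_I : iIndepFun (fun p : ℕ × Fin m × ℕ => I p.1 p.2.1 p.2.2) P
  indep_V_I : IndepFun (fun ω (p : ℕ × Fin m) => V p.1 p.2 ω)
    (fun ω (p : ℕ × Fin m × ℕ) => I p.1 p.2.1 p.2.2 ω) P
  indep_Q₀_V_I : IndepFun (fun ω i => Q₀ i ω)
    (fun ω => ((fun p : ℕ × Fin m => V p.1 p.2 ω),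
      (fun p : ℕ × Fin m × ℕ => I p.1 p.2.1 p.2.2 ω))) P

/-- The sample pool at level `j` output by the algorithm. -/
def pool (Q₀ : Fin m → Ω → ℝ) (V : ℕ → Fin m → Ω → BranchVec)
    (I : ℕ → Fin m → ℕ → Ω → Fin m) : ℕ → Ω → Fin m → ℝ
  | 0, ω, i => Q₀ i ω
  | j + 1, ω, i =>
      (∑ r ∈ Finset.range (BranchVec.N (V j i ω)),
        BranchVec.C (V j i ω) r * pool Q₀ V I j ω (I j i r ω))
      + BranchVec.Q (V j i ω)

/-- The empirical distribution `m⁻¹ ∑ δ_{x i}` of a pool. -/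
def empirical (x : Fin m → ℝ) : Measure ℝ :=
  (m : ℝ≥0∞)⁻¹ • ∑ i, Measure.dirac (x i)

end Algorithm

/-- The joint probability measures on `ℝ × ℝ` with marginals `μ` and `ν`. -/
def couplings (μ ν : Measure ℝ) : Set (Measure (ℝ × ℝ)) :=
  {π | IsProbabilityMeasure π ∧ π.map Prod.fst = μ ∧ π.map Prod.snd = ν}

/-- The Kantorovich–Rubinstein (Wasserstein-1) distance on the real line. -/
def d1 (μ ν : Measure ℝ) : ℝ≥0∞ :=
  ⨅ π ∈ couplings μ ν, ∫⁻ p, ENNReal.ofReal |p.1 - p.2| ∂π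

end IterBootstrap

end

/-! The distance `d1` is replaced by the larger `cdfDist`, the `L¹` distance of distribution
functions, which is measurable in the pool and is attained as a bound by the quantile coupling. The
tree drops out as well: splitting it at the root shows that `F_k` satisfies `F_{k+1} = T F_k`, where
`T` is the smoothing transform (`map_treeR_infinitePi`).

Given a pool `x`, the next pool is an i.i.d. sample from `T (empirical x)` (`map_nextPool`). Couple
`empirical x` with `F_n` by quantiles, and feed i.i.d. coupled pairs through the same branching
vectors. Each member is then paired with a member of an i.i.d. sample from `F_{n+1}`, at expected
cost at most `ρ₁ · cdfDist (empirical x) F_n`. The triangle inequality adds only the error `D` of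
i.i.d. sampling (`lintegral_cdfDist_smoothing_le`). Iteration over the levels gives `D ∑ ρ₁^i`, the
last term coming from the initial pool.

For `D`, the expected deviation of an empirical distribution function at `t` is at most both
`√(g/m)` and `2g`, where `g = M |t|^(-α)` bounds `F(t)(1 - F(t))` by Markov's inequality.
Integrating the first bound for `|t| ≤ m^(1/α)` and the second beyond gives the order `m^(-1+1/α)`;
here `1 < α < 2` is what makes both integrals finite.

It remains to bound the `α`th moments of all `F_k` by one `M`. In case (i), `ρ_α < 1` by convexity;
first moments are bounded by contraction, and then an affine recursion bounds the `α`th moments. In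
case (ii) first moments need not contract, but centring removes the cross terms, so second moments
satisfy an affine recursion with ratio `ρ₂ < 1`. -/

noncomputable section

namespace IterBootstrap

/-! ### Splitting infinite product measures -/

section ProductMeasures

open Measure

/-- Splitting off one coordinate of an infinite product of copies of `ν`. -/
lemma map_optionElim_prod_infinitePi {X κ : Type*} [MeasurableSpace X] (ν : Measure X)
    [IsProbabilityMeasure ν] :
    (ν.prod (infinitePi fun _ : κ => ν)).map (fun p (o : Option κ) => o.elim p.1 p.2) =
      infinitePi fun _ : Option κ => ν := by
  classical
  have hm : Measurable (fun (p : X × (κ → X)) (o : Option κ) => o.elim p.1 p.2) := by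
    refine measurable_pi_lambda _ fun o => ?_
    cases o with
    | none => exact measurable_fst
    | some k => exact (measurable_pi_apply k).comp measurable_snd
  refine eq_infinitePi _ fun s t ht => ?_
  rw [map_apply hm (.pi s.countable_toSet fun _ _ => ht _)]
  have h : (fun (p : X × (κ → X)) (o : Option κ) => o.elim p.1 p.2) ⁻¹' (Set.pi s t) =
      (if none ∈ s then t none else Set.univ) ×ˢ
        Set.pi (Finset.eraseNone s) (fun k => t (some k)) := by
    ext p
    simp only [Set.mem_preimage, Set.mem_pi, Set.mem_prod, Finset.mem_coe, Finset.mem_eraseNone]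
    constructor
    · intro h
      refine ⟨?_, fun k hk => h _ hk⟩
      split_ifs with hn
      · exact h _ hn
      · trivial
    · rintro ⟨h1, h2⟩ o ho
      cases o with
      | none => simpa [ho] using h1
      | some k => exact h2 k ho
  rw [h, prod_prod, infinitePi_pi _ (fun k _ => ht _)]
  by_cases hn : none ∈ s
  · rw [if_pos hn, ← Finset.insert_erase hn, Finset.prod_insert (Finset.notMem_erase _ _),
      Finset.insert_erase hn]
    congr 1
    rw [← Finset.map_some_eraseNone, Finset.prod_map]
    rfl
  · rw [if_neg hn, measure_univ, one_mul]
    conv_rhs => rw [← Finset.erase_eq_of_notMem hn, ← Finset.map_some_eraseNone, Finset.prod_map]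
    rfl

/-- Serves two splittings: a tree into its root and the subtrees below it, and a sequence into its
first term and its tail. -/
lemma map_equiv_optionElim_prod_infinitePi {X κ ι : Type*} [MeasurableSpace X] (ν : Measure X)
    [IsProbabilityMeasure ν] (e : ι ≃ Option κ) :
    (ν.prod (infinitePi fun _ : κ => ν)).map (fun p (i : ι) => (e i).elim p.1 p.2) =
      infinitePi fun _ : ι => ν := by
  have hm : Measurable (fun (p : X × (κ → X)) (o : Option κ) => o.elim p.1 p.2) := by
    refine measurable_pi_lambda _ fun o => ?_
    cases o with
    | none => exact measurable_fst
    | some k => exact (measurable_pi_apply k).comp measurable_snd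
  rw [← map_infinitePi_infinitePi_of_inj (P := fun _ : Option κ => ν) e.injective,
    ← map_optionElim_prod_infinitePi, map_map (by fun_prop) hm]
  rfl

end ProductMeasures

/-! ### Measurability of random sums -/

section Measurability

/-- The random length takes countably many values, and for each of them the sum is a finite sum of
measurable functions. -/
lemma measurable_sum_range {A M : Type*} [MeasurableSpace A] [MeasurableSpace M]
    [AddCommMonoid M] [MeasurableAdd₂ M] {N : A → ℕ} (hN : Measurable N) {f : ℕ → A → M}
    (hf : ∀ i, Measurable (f i)) : Measurable fun a => ∑ i ∈ Finset.range (N a), f i a :=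
  (measurable_from_prod_countable_right (f := fun p : ℕ × A => ∑ i ∈ Finset.range p.1, f i p.2)
    fun n => Finset.measurable_sum (Finset.range n) fun i _ => hf i).comp
      (hN.prodMk measurable_id)

@[fun_prop] lemma measurable_Q : Measurable BranchVec.Q := measurable_fst

@[fun_prop] lemma measurable_N : Measurable BranchVec.N := measurable_snd.fst

@[fun_prop] lemma measurable_C (r : ℕ) : Measurable fun v => BranchVec.C v r :=
  (measurable_pi_apply r).comp measurable_snd.snd

end Measurability

/-- The value `∑_{r < N} C_r x_r + Q` of a node with branching vector `v` whose children have
the values `x r`. -/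
def step (v : BranchVec) (x : ℕ → ℝ) : ℝ :=
  (∑ r ∈ Finset.range (BranchVec.N v), BranchVec.C v r * x r) + BranchVec.Q v

lemma measurable_step : Measurable fun p : BranchVec × (ℕ → ℝ) => step p.1 p.2 :=
  (measurable_sum_range (measurable_N.comp measurable_fst) fun r =>
    ((measurable_C r).comp measurable_fst).mul
      ((measurable_pi_apply r).comp measurable_snd)).add (measurable_Q.comp measurable_fst)

/-- The law of `∑_{r < N} C_r X_r + Q` for i.i.d. `X_r` with law `ν`, independent of the
branching vector. -/
def smoothing (μ : Measure BranchVec) (ν : Measure ℝ) : Measure ℝ :=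
  (μ.prod (Measure.infinitePi fun _ : ℕ => ν)).map fun p => step p.1 p.2

instance (μ : Measure BranchVec) [IsProbabilityMeasure μ] (ν : Measure ℝ)
    [IsProbabilityMeasure ν] : IsProbabilityMeasure (smoothing μ ν) :=
  Measure.isProbabilityMeasure_map measurable_step.aemeasurable

/-- The law of `R^{(k)}`, described by the smoothing recursion. -/
def lawR (μ : Measure BranchVec) : ℕ → Measure ℝ
  | 0 => μ.map BranchVec.Q
  | k + 1 => smoothing μ (lawR μ k)

instance (μ : Measure BranchVec) [IsProbabilityMeasure μ] (k : ℕ) :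
    IsProbabilityMeasure (lawR μ k) := by
  induction k with
  | zero => exact Measure.isProbabilityMeasure_map measurable_Q.aemeasurable
  | succ k ih => exact inferInstanceAs (IsProbabilityMeasure (smoothing μ (lawR μ k)))

/-! ### The law of `R^{(k)}` through the root recursion -/

section Tree

variable {Ω : Type*}

/-- `generation` extends the tree at its leaves, whereas the recursion for the law needs it split at
the root. A path is stored in reverse, so the child of the root is the last entry and its subtree
carries the family `V (i ++ [r])`. -/
lemma generation_succ_eq_biUnion_root (V : List ℕ → Ω → BranchVec) (ω : Ω) (n : ℕ) :
    generation V ω (n + 1) = (Finset.range (BranchVec.N (V [] ω))).biUnion fun r =>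
      (generation (fun i => V (i ++ [r])) ω n).image fun i => i ++ [r] := by
  induction n with
  | zero => ext l; simp [generation, eq_comm]
  | succ n ih =>
    rw [generation, ih]
    ext l
    simp only [generation, Finset.mem_biUnion, Finset.mem_image]
    constructor
    · rintro ⟨_, ⟨r, hr, i, hi, rfl⟩, q, hq, rfl⟩
      exact ⟨r, hr, q :: i, ⟨i, hi, q, hq, rfl⟩, rfl⟩
    · rintro ⟨r, hr, _, ⟨i, hi, q, hq, rfl⟩, rfl⟩
      exact ⟨i ++ [r], ⟨r, hr, i, hi, rfl⟩, q, hq, rfl⟩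

lemma weight_append_singleton (V : List ℕ → Ω → BranchVec) (ω : Ω) (r : ℕ) (i : List ℕ) :
    weight V ω (i ++ [r]) =
      BranchVec.C (V [] ω) r * weight (fun i => V (i ++ [r])) ω i := by
  induction i with
  | nil => simp [weight]
  | cons q i ih => simp only [List.cons_append, weight, ih]; ring

/-- The recursion for `R^{(k)}` obtained by splitting the tree at its root. -/
lemma R_succ (V : List ℕ → Ω → BranchVec) (k : ℕ) (ω : Ω) :
    R V (k + 1) ω = step (V [] ω) fun r => R (fun i => V (i ++ [r])) k ω := by
  rw [R, Finset.sum_range_succ', step]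
  congr 1
  · simp only [R, Finset.mul_sum]
    rw [Finset.sum_comm]
    refine Finset.sum_congr rfl fun j _ => ?_
    rw [generation_succ_eq_biUnion_root, Finset.sum_biUnion]
    · refine Finset.sum_congr rfl fun r _ => ?_
      rw [Finset.sum_image fun a _ b _ h => List.append_cancel_right h]
      refine Finset.sum_congr rfl fun i _ => ?_
      rw [weight_append_singleton]; ring
    -- Subtrees of distinct children are disjoint because the last entry of a node determines the
    -- child.
    · intro a _ b _ hab
      rw [Function.onFun, Finset.disjoint_left]
      intro l hl hl'
      obtain ⟨i, _, rfl⟩ := Finset.mem_image.1 hl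
      obtain ⟨i', _, h⟩ := Finset.mem_image.1 hl'
      exact hab (by simpa using (List.append_inj' h rfl).2.symm)
  · simp [generation, weight]

lemma R_zero (V : List ℕ → Ω → BranchVec) (ω : Ω) : R V 0 ω = BranchVec.Q (V [] ω) := by
  simp [R, generation, weight]

/-- `R^{(k)}` as a function of the whole tree of branching vectors. -/
def treeR (k : ℕ) (z : List ℕ → BranchVec) : ℝ := R (fun i z => z i) k z

lemma R_eq_treeR (V : List ℕ → Ω → BranchVec) (k : ℕ) (ω : Ω) :
    R V k ω = treeR k fun i => V i ω := by
  have hg (n : ℕ) : generation V ω n = generation (fun i z => z i) (fun i => V i ω) n := by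
    induction n with
    | zero => rfl
    | succ n ih => simp only [generation, ih]
  have hw (i : List ℕ) : weight V ω i = weight (fun i z => z i) (fun i => V i ω) i := by
    induction i with
    | nil => rfl
    | cons r i ih => simp only [weight, ih]
  simp only [treeR, R, hg, hw]

lemma treeR_succ (k : ℕ) (z : List ℕ → BranchVec) :
    treeR (k + 1) z = step (z []) fun r => treeR k fun i => z (i ++ [r]) := by
  rw [treeR, R_succ]
  congr 1
  ext r
  rw [R_eq_treeR]

lemma measurable_treeR (k : ℕ) : Measurable (treeR k) := by
  induction k with
  | zero =>
    rw [show treeR 0 = fun z => BranchVec.Q (z []) from funext fun z => R_zero _ z]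
    fun_prop
  | succ k ih =>
    rw [show treeR (k + 1) = _ from funext fun z => treeR_succ k z]
    have h : Measurable fun (z : List ℕ → BranchVec) (r : ℕ) =>
        treeR k fun i => z (i ++ [r]) :=
      measurable_pi_lambda _ fun r => ih.comp (by fun_prop)
    exact measurable_step.comp (f := fun z : List ℕ → BranchVec =>
      (z [], fun r => treeR k fun i => z (i ++ [r]))) ((measurable_pi_apply _).prodMk h)

/-- A node is the root or a node of the subtree of some child of the root. -/
def splitRoot : List ℕ ≃ Option (ℕ × List ℕ) where
  toFun l := match l.reverse with
    | [] => none
    | r :: t => some (r, t.reverse)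
  invFun o := o.elim [] fun p => p.2 ++ [p.1]
  left_inv l := by
    induction l using List.reverseRecOn with
    | nil => rfl
    | append_singleton l r => simp
  right_inv o := by cases o <;> simp

/-- The subtrees of the children of the root are independent copies of the whole tree, independent
of the root, so one level of the tree is one application of `smoothing`. -/
lemma map_treeR_infinitePi (μ : Measure BranchVec) [IsProbabilityMeasure μ] (k : ℕ) :
    (Measure.infinitePi fun _ : List ℕ => μ).map (treeR k) = lawR μ k := by
  induction k with
  | zero =>
    conv_rhs => rw [lawR, ← Measure.infinitePi_map_eval (fun _ : List ℕ => μ) [],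
      Measure.map_map measurable_Q (by fun_prop)]
    rw [show treeR 0 = fun z => BranchVec.Q (z []) from funext fun z => R_zero _ z]
    rfl
  | succ k ih =>
    have hg : Measurable fun (p : BranchVec × (ℕ × List ℕ → BranchVec)) (i : List ℕ) =>
        (splitRoot i).elim p.1 p.2 := by
      refine measurable_pi_lambda _ fun o => ?_
      cases splitRoot o with
      | none => exact measurable_fst
      | some k => exact (measurable_pi_apply k).comp measurable_snd
    have hF : Measurable fun (w : ℕ → List ℕ → BranchVec) (r : ℕ) => treeR k (w r) :=
      measurable_pi_lambda _ fun r => (measurable_treeR k).comp (measurable_pi_apply r)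
    have h1 : (Measure.infinitePi fun _ : ℕ => lawR μ k) =
        (Measure.infinitePi fun _ : ℕ × List ℕ => μ).map
          ((fun (w : ℕ → List ℕ → BranchVec) (r : ℕ) => treeR k (w r)) ∘
            MeasurableEquiv.curry ℕ (List ℕ) BranchVec) := by
      rw [← Measure.map_map hF (by fun_prop),
        Measure.infinitePi_map_curry (fun (_ : ℕ) (_ : List ℕ) => μ),
        Measure.infinitePi_map_pi _ fun _ => measurable_treeR k]
      simp only [ih]
    have h2 : μ.prod (Measure.infinitePi fun _ : ℕ => lawR μ k) =
        (μ.prod (Measure.infinitePi fun _ : ℕ × List ℕ => μ)).map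
          (Prod.map id ((fun (w : ℕ → List ℕ → BranchVec) (r : ℕ) => treeR k (w r)) ∘
            MeasurableEquiv.curry ℕ (List ℕ) BranchVec)) := by
      rw [← Measure.map_prod_map _ _ measurable_id (hF.comp (by fun_prop)), Measure.map_id, ← h1]
    rw [lawR, smoothing, h2, ← map_equiv_optionElim_prod_infinitePi μ splitRoot,
      Measure.map_map (measurable_treeR _) hg, Measure.map_map measurable_step
        (measurable_id.prodMap (hF.comp (by fun_prop)))]
    congr 1
    ext p
    simp only [Function.comp_apply, treeR_succ]
    congr 1
    ext r
    simp only [Prod.map_snd, Function.comp_apply]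
    congr 1
    ext i : 1
    change (splitRoot (splitRoot.symm (some (r, i)))).elim p.1 p.2 = _
    simp [MeasurableEquiv.curry]

lemma IsBranchingFamily.map_R [MeasurableSpace Ω] {μ : Measure BranchVec}
    [IsProbabilityMeasure μ] {P : Measure Ω} {V : List ℕ → Ω → BranchVec}
    (h : IsBranchingFamily μ P V) (k : ℕ) : P.map (R V k) = lawR μ k := by
  rw [← map_treeR_infinitePi, funext fun ω => R_eq_treeR V k ω]
  have := h.indep.map_fun_eq_infinitePi_map h.measurable
  simp only [h.law] at this
  rw [← this, Measure.map_map (measurable_treeR k) (measurable_pi_lambda _ h.measurable)]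
  rfl

end Tree

/-! ### Distribution functions and the quantile coupling -/

section CdfDist

open Set Filter Topology

/-- The `L¹` distance of the distribution functions of two measures on the real line. -/
def cdfDist (μ ν : Measure ℝ) : ℝ≥0∞ :=
  ∫⁻ t, ENNReal.ofReal |μ.real (Iic t) - ν.real (Iic t)|

lemma measurable_real_Iic (μ : Measure ℝ) [IsFiniteMeasure μ] :
    Measurable fun t => μ.real (Iic t) :=
  Monotone.measurable fun _ _ h => measureReal_mono (Iic_subset_Iic.2 h)

lemma cdfDist_triangle (μ ν κ : Measure ℝ) [IsFiniteMeasure μ] [IsFiniteMeasure ν] :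
    cdfDist μ κ ≤ cdfDist μ ν + cdfDist ν κ := by
  have h1 := measurable_real_Iic μ
  have h2 := measurable_real_Iic ν
  rw [cdfDist, cdfDist, cdfDist, ← lintegral_add_left (by fun_prop)]
  refine lintegral_mono fun t => ?_
  rw [← ENNReal.ofReal_add (abs_nonneg _) (abs_nonneg _)]
  exact ENNReal.ofReal_le_ofReal (abs_sub_le _ _ _)

/-- The integrand is the indicator of the interval between `a` and `b`. Its mirror image below has
the threshold on the other side of the inequality and serves to integrate over quantile levels. -/
lemma lintegral_abs_ite_le_sub_ite_le (a b : ℝ) :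
    ∫⁻ t, ENNReal.ofReal |(if a ≤ t then (1 : ℝ) else 0) - if b ≤ t then 1 else 0| =
      ENNReal.ofReal |a - b| := by
  wlog h : a ≤ b generalizing a b
  · rw [abs_sub_comm a b, ← this b a (le_of_not_ge h)]
    exact lintegral_congr fun t => by rw [abs_sub_comm]
  have : (fun t => ENNReal.ofReal |(if a ≤ t then (1 : ℝ) else 0) - if b ≤ t then 1 else 0|) =
      (Ico a b).indicator 1 := by
    ext t
    by_cases h1 : a ≤ t <;> by_cases h2 : b ≤ t <;> simp [indicator, h1, h2]
    exact absurd (h.trans h2) h1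
  rw [this, lintegral_indicator_one measurableSet_Ico, Real.volume_Ico, abs_sub_comm,
    abs_of_nonneg (sub_nonneg.2 h)]

lemma lintegral_abs_ite_ge_sub_ite_ge (a b : ℝ) :
    ∫⁻ t, ENNReal.ofReal |(if t ≤ a then (1 : ℝ) else 0) - if t ≤ b then 1 else 0| =
      ENNReal.ofReal |a - b| := by
  wlog h : a ≤ b generalizing a b
  · rw [abs_sub_comm a b, ← this b a (le_of_not_ge h)]
    exact lintegral_congr fun t => by rw [abs_sub_comm]
  have : (fun t => ENNReal.ofReal |(if t ≤ a then (1 : ℝ) else 0) - if t ≤ b then 1 else 0|) =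
      (Ioc a b).indicator 1 := by
    ext t
    by_cases h1 : t ≤ a <;> by_cases h2 : t ≤ b <;> simp [indicator, h1, h2, not_lt.2, not_le.1]
    exact absurd (h1.trans h) h2
  rw [this, lintegral_indicator_one measurableSet_Ioc, Real.volume_Ioc, abs_sub_comm,
    abs_of_nonneg (sub_nonneg.2 h)]

/-- The quantile function of a measure on the real line, set to `0` outside `(0, 1)`. -/
def quantile (ν : Measure ℝ) (u : ℝ) : ℝ :=
  open scoped Classical in if u ∈ Ioo (0 : ℝ) 1 then sInf {t | u ≤ ν.real (Iic t)} else 0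

/-- Right continuity of the distribution function makes the infimum attained; `0 < u < 1` makes the
set nonempty and bounded below. -/
lemma quantile_le_iff (ν : Measure ℝ) [IsProbabilityMeasure ν] {u : ℝ} (hu : u ∈ Ioo (0 : ℝ) 1)
    (t : ℝ) : quantile ν u ≤ t ↔ u ≤ ν.real (Iic t) := by
  rw [quantile, if_pos hu]
  simp only [← cdf_eq_real]
  have hb : BddBelow {t | u ≤ cdf ν t} := by
    obtain ⟨s, hs⟩ := ((tendsto_cdf_atBot ν).eventually (gt_mem_nhds hu.1)).exists
    refine ⟨s, fun r hr => le_of_not_gt fun hlt => ?_⟩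
    exact absurd (hr.trans (monotone_cdf ν hlt.le)) (not_le.2 hs)
  have hne : {t | u ≤ cdf ν t}.Nonempty := by
    obtain ⟨s, hs⟩ := ((tendsto_cdf_atTop ν).eventually (lt_mem_nhds hu.2)).exists
    exact ⟨s, hs.le⟩
  refine ⟨fun h => ?_, fun h => csInf_le hb h⟩
  have hc : Tendsto (cdf ν) (𝓝[>] t) (𝓝 (cdf ν t)) :=
    ((cdf ν).right_continuous t).mono_left (nhdsWithin_mono _ Ioi_subset_Ici_self)
  refine ge_of_tendsto hc (eventually_nhdsWithin_of_forall fun s hs => ?_)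
  obtain ⟨r, hr, hrs⟩ := (csInf_lt_iff hb hne).1 (h.trans_lt hs)
  exact le_trans hr (monotone_cdf ν hrs.le)

lemma measurable_quantile (ν : Measure ℝ) [IsProbabilityMeasure ν] : Measurable (quantile ν) := by
  refine measurable_of_Iic fun t => ?_
  have : quantile ν ⁻¹' Iic t =
      (Ioo (0 : ℝ) 1 ∩ Iic (ν.real (Iic t))) ∪ ((Ioo (0 : ℝ) 1)ᶜ ∩ {_u | (0 : ℝ) ≤ t}) := by
    ext u
    by_cases hu : u ∈ Ioo (0 : ℝ) 1
    · simp only [mem_preimage, mem_Iic, mem_union, mem_inter_iff, hu, mem_compl_iff,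
        quantile_le_iff ν hu t]
      simp
    · simp only [mem_preimage, mem_Iic, mem_union, mem_inter_iff, hu, mem_compl_iff, quantile]
      simp
  rw [this]
  exact (measurableSet_Ioo.inter measurableSet_Iic).union
    (measurableSet_Ioo.compl.inter (MeasurableSet.const _))

instance : IsProbabilityMeasure ((volume : Measure ℝ).restrict (Ioo 0 1)) := ⟨by simp⟩

lemma map_quantile (ν : Measure ℝ) [IsProbabilityMeasure ν] :
    ((volume : Measure ℝ).restrict (Ioo 0 1)).map (quantile ν) = ν := by
  have := Measure.isProbabilityMeasure_map (μ := (volume : Measure ℝ).restrict (Ioo 0 1))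
    (measurable_quantile ν).aemeasurable
  refine Measure.ext_of_Iic _ _ fun t => ?_
  rw [Measure.map_apply (measurable_quantile ν) measurableSet_Iic,
    Measure.restrict_apply (measurable_quantile ν measurableSet_Iic)]
  have h : quantile ν ⁻¹' Iic t ∩ Ioo (0 : ℝ) 1 = Ioo (0 : ℝ) 1 ∩ Iic (ν.real (Iic t)) := by
    ext u
    constructor
    · rintro ⟨h1, h2⟩; exact ⟨h2, (quantile_le_iff ν h2 t).1 h1⟩
    · rintro ⟨h1, h2⟩; exact ⟨(quantile_le_iff ν h1 t).2 h2, h1⟩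
  -- The endpoint `1` is added so that the intersection is an interval also when the distribution
  -- function equals `1`.
  have h' : volume (Ioo (0 : ℝ) 1 ∩ Iic (ν.real (Iic t))) =
      volume (Ioc (0 : ℝ) 1 ∩ Iic (ν.real (Iic t))) :=
    measure_congr (Ioo_ae_eq_Ioc.inter (ae_eq_refl _))
  rw [h, h', Ioc_inter_Iic,
    min_eq_right measureReal_le_one, Real.volume_Ioc, sub_zero, ofReal_measureReal]

/-- The cost of the quantile coupling is at most the distance of the distribution functions. -/
lemma exists_mem_couplings_le_cdfDist (μ ν : Measure ℝ) [IsProbabilityMeasure μ]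
    [IsProbabilityMeasure ν] :
    ∃ π ∈ couplings μ ν, ∫⁻ p, ENNReal.ofReal |p.1 - p.2| ∂π ≤ cdfDist μ ν := by
  have hμ := measurable_quantile μ
  have hν := measurable_quantile ν
  set l := (volume : Measure ℝ).restrict (Ioo 0 1)
  refine ⟨l.map fun u => (quantile μ u, quantile ν u), ?_, ?_⟩
  · refine ⟨Measure.isProbabilityMeasure_map (by fun_prop), ?_, ?_⟩
    · rw [Measure.map_map measurable_fst (by fun_prop)]; exact map_quantile μ
    · rw [Measure.map_map measurable_snd (by fun_prop)]; exact map_quantile ν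
  rw [lintegral_map (by fun_prop) (by fun_prop)]
  -- The distance of the quantiles at level `u` is an integral over thresholds `t`. After Tonelli,
  -- `quantile ≤ t` turns into `u ≤ F(t)`, and the integral over `u` is at most the difference of
  -- the distribution functions at `t`.
  rw [lintegral_congr fun u =>
    (lintegral_abs_ite_le_sub_ite_le (quantile μ u) (quantile ν u)).symm, lintegral_lintegral_swap]
  · refine lintegral_mono fun t => ?_
    rw [← lintegral_abs_ite_ge_sub_ite_ge]
    refine le_trans (le_of_eq ?_) (setLIntegral_le_lintegral (Ioo (0 : ℝ) 1) _)
    refine setLIntegral_congr_fun measurableSet_Ioo fun u hu => ?_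
    simp only [quantile_le_iff μ hu t, quantile_le_iff ν hu t]
  · refine Measurable.aemeasurable (Measurable.ennreal_ofReal (Measurable.abs
      ((Measurable.ite ?_ measurable_const measurable_const).sub
        (Measurable.ite ?_ measurable_const measurable_const))))
    · exact measurableSet_le (hμ.comp measurable_fst) measurable_snd
    · exact measurableSet_le (hν.comp measurable_fst) measurable_snd

lemma d1_le_cdfDist (μ ν : Measure ℝ) [IsProbabilityMeasure μ] [IsProbabilityMeasure ν] :
    d1 μ ν ≤ cdfDist μ ν :=
  let ⟨π, hπ, h⟩ := exists_mem_couplings_le_cdfDist μ ν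
  (iInf₂_le π hπ).trans h

end CdfDist

/-! ### Empirical measures -/

section Empirical

open Set

variable {m : ℕ}

lemma empirical_apply (x : Fin m → ℝ) {s : Set ℝ} (hs : MeasurableSet s) :
    empirical x s = (m : ℝ≥0∞)⁻¹ * ∑ i, s.indicator 1 (x i) := by
  simp [empirical, Measure.dirac_apply' _ hs]

lemma isProbabilityMeasure_empirical (hm : 1 ≤ m) (x : Fin m → ℝ) :
    IsProbabilityMeasure (empirical x) := by
  refine ⟨?_⟩
  rw [empirical_apply x .univ]
  simpa using ENNReal.inv_mul_cancel (by simp; lia) (ENNReal.natCast_ne_top m)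

lemma empirical_real_Iic (x : Fin m → ℝ) (t : ℝ) :
    (empirical x).real (Iic t) = (m : ℝ)⁻¹ * ∑ i, if x i ≤ t then 1 else 0 := by
  rw [measureReal_def, empirical_apply x measurableSet_Iic, ENNReal.toReal_mul,
    ENNReal.toReal_sum (fun i _ => by by_cases h : x i ≤ t <;> simp [indicator, h])]
  simp only [ENNReal.toReal_inv, ENNReal.toReal_natCast]
  congr 1
  refine Finset.sum_congr rfl fun i _ => ?_
  by_cases h : x i ≤ t <;> simp [indicator, h]

/-- Identifies a draw at a uniform position of the pool with a draw from the empirical law. -/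
lemma map_uniformOn_univ (x : Fin m → ℝ) :
    (uniformOn (univ : Set (Fin m))).map x = empirical x := by
  ext s hs
  rw [Measure.map_apply (measurable_of_finite x) hs, uniformOn_univ, empirical_apply x hs,
    ENNReal.div_eq_inv_mul]
  simp only [Fintype.card_fin]
  congr 1
  rw [Measure.count, Measure.sum_apply _ (measurable_of_finite x hs), tsum_fintype]
  refine Finset.sum_congr rfl fun i _ => ?_
  rw [Measure.dirac_apply' _ (measurable_of_finite x hs)]
  rfl

/-- Pairing `x i` with `y i` writes the difference of the distribution functions as an average of
differences of step functions. -/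
lemma cdfDist_empirical_le (x y : Fin m → ℝ) :
    cdfDist (empirical x) (empirical y) ≤
      (m : ℝ≥0∞)⁻¹ * ∑ i, ENNReal.ofReal |x i - y i| := by
  rw [Finset.sum_congr rfl fun i _ => (lintegral_abs_ite_le_sub_ite_le (x i) (y i)).symm]
  have hmeas (a b : ℝ) : Measurable fun t : ℝ =>
      ENNReal.ofReal |(if a ≤ t then (1 : ℝ) else 0) - if b ≤ t then 1 else 0| :=
    Measurable.ennreal_ofReal (Measurable.abs
      ((Measurable.ite measurableSet_Ici measurable_const measurable_const).sub
        (Measurable.ite measurableSet_Ici measurable_const measurable_const)))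
  rw [← lintegral_finsetSum _ fun i _ => hmeas _ _, ← lintegral_const_mul _
    (Finset.measurable_sum _ fun i _ => hmeas _ _)]
  refine lintegral_mono fun t => ?_
  simp only [empirical_real_Iic]
  rw [← mul_sub, abs_mul, ← Finset.sum_sub_distrib, ENNReal.ofReal_mul (abs_nonneg _),
    ← ENNReal.ofReal_sum_of_nonneg fun _ _ => abs_nonneg _]
  refine mul_le_mul' ?_ (ENNReal.ofReal_le_ofReal (Finset.abs_sum_le_sum_abs _ _))
  -- For an empty pool the inverse of `0` is `0` in `ℝ` but `⊤` in `ℝ≥0∞`, which is still the right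
  -- direction.
  rcases Nat.eq_zero_or_pos m with rfl | hm
  · simp
  rw [abs_of_nonneg (by positivity), ENNReal.ofReal_inv_of_pos (by positivity),
    ENNReal.ofReal_natCast]

lemma measurable_cdfDist_empirical_uncurry (ν : Measure ℝ) [IsFiniteMeasure ν] :
    Measurable fun p : (Fin m → ℝ) × ℝ =>
      ENNReal.ofReal |(empirical p.1).real (Iic p.2) - ν.real (Iic p.2)| := by
  simp only [empirical_real_Iic]
  have h := measurable_real_Iic ν
  refine Measurable.ennreal_ofReal (Measurable.abs (Measurable.sub
    (Measurable.const_mul (Finset.measurable_sum _ fun i _ =>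
      Measurable.ite ?_ measurable_const measurable_const) _) (h.comp measurable_snd)))
  exact measurableSet_le ((measurable_pi_apply i).comp measurable_fst) measurable_snd

lemma measurable_cdfDist_empirical (ν : Measure ℝ) [IsFiniteMeasure ν] :
    Measurable fun x : Fin m → ℝ => cdfDist (empirical x) ν :=
  (measurable_cdfDist_empirical_uncurry ν).lintegral_prod_right'

end Empirical

/-! ### The error of i.i.d. sampling -/

section EmpiricalRate

open Set

variable {m : ℕ}

/-- The centred empirical distribution function at a point: second and first moment bounds. -/
lemma lintegral_empirical_real_Iic_sub_le (hm : 1 ≤ m) (F : Measure ℝ) [IsProbabilityMeasure F]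
    (t : ℝ) {g : ℝ} (hg : F.real (Iic t) * (1 - F.real (Iic t)) ≤ g) :
    ∫⁻ y, ENNReal.ofReal |(empirical y).real (Iic t) - F.real (Iic t)|
        ∂(Measure.pi fun _ : Fin m => F) ≤ ENNReal.ofReal (√(g / m)) ∧
    ∫⁻ y, ENNReal.ofReal |(empirical y).real (Iic t) - F.real (Iic t)|
        ∂(Measure.pi fun _ : Fin m => F) ≤ ENNReal.ofReal (2 * g) := by
  have hm0 : (0 : ℝ) < m := by exact_mod_cast hm
  set p := F.real (Iic t) with hp
  have hp0 : 0 ≤ p := measureReal_nonneg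
  have hp1 : p ≤ 1 := measureReal_le_one
  set X : ℝ → ℝ := fun y => if y ≤ t then 1 else 0 with hX
  have hXm : Measurable X := Measurable.ite measurableSet_Iic measurable_const measurable_const
  have hXb (y : ℝ) : ‖X y‖ ≤ 1 := by simp only [hX]; split_ifs <;> simp
  have hXL : MemLp X 2 F := MemLp.of_bound hXm.aestronglyMeasurable 1 (ae_of_all _ hXb)
  have hXi : ∫ y, X y ∂F = p := by
    have : X = (Iic t).indicator fun _ => 1 := by ext y; simp [hX, indicator]
    rw [this, integral_indicator measurableSet_Iic]
    simp [hp]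
  have hXv : Var[X; F] = p * (1 - p) := by
    rw [variance_eq_sub hXL, hXi]
    have : X ^ 2 = X := by ext y; simp only [hX, Pi.pow_apply]; split_ifs <;> simp
    rw [this, hXi]; ring
  set P := Measure.pi fun _ : Fin m => F
  set S : (Fin m → ℝ) → ℝ := fun y => ∑ i, X (y i)
  have hYL (i : Fin m) : MemLp (fun y : Fin m → ℝ => X (y i)) 2 P :=
    MemLp.of_bound (hXm.comp (measurable_pi_apply i)).aestronglyMeasurable 1
      (ae_of_all _ fun y => hXb _)
  have hYi (f : ℝ → ℝ) (hf : Measurable f) (i : Fin m) : ∫ y, f (y i) ∂P = ∫ y, f y ∂F := by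
    have h := (measurePreserving_eval (fun _ : Fin m => F) i)
    conv_rhs => rw [← h.map_eq]
    rw [integral_map h.measurable.aemeasurable hf.aestronglyMeasurable]
  have hSi : ∫ y, S y ∂P = m * p := by
    rw [integral_finsetSum _ fun i _ => (hYL i).integrable (by norm_num)]
    simp [hYi X hXm, hXi]
  have hSv : ∫ y, (S y - m * p) ^ 2 ∂P = m * (p * (1 - p)) := by
    have h1 : Var[∑ i, fun y : Fin m → ℝ => X (y i); P] = ∑ _i : Fin m, Var[X; F] :=
      variance_sum_pi fun _ => hXL
    have h2 : (∑ i, fun y : Fin m → ℝ => X (y i)) = S := by ext y; simp [S]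
    have hSm : Measurable S :=
      Finset.measurable_sum _ fun i _ => hXm.comp (measurable_pi_apply i)
    rw [h2, variance_eq_integral hSm.aemeasurable, hSi] at h1
    simpa [hXv] using h1
  have hD (y : Fin m → ℝ) : (empirical y).real (Iic t) - p = (m : ℝ)⁻¹ * (S y - m * p) := by
    rw [empirical_real_Iic]
    field_simp
    rfl
  have hDL : MemLp (fun y : Fin m → ℝ => (empirical y).real (Iic t) - p) 2 P := by
    simp only [hD]
    exact ((memLp_finsetSum _ fun i _ => hYL i).sub (memLp_const _)).const_mul _
  have hDi : Integrable (fun y : Fin m → ℝ => |(empirical y).real (Iic t) - p|) P :=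
    (hDL.integrable (by norm_num)).abs
  rw [← ofReal_integral_eq_lintegral_ofReal hDi (ae_of_all _ fun _ => abs_nonneg _)]
  constructor
  -- Nonnegativity of the variance of `|D|` gives `(E|D|)² ≤ E D² = p(1 - p)/m`.
  · refine ENNReal.ofReal_le_ofReal (Real.le_sqrt_of_sq_le ?_)
    have h1 := variance_nonneg (fun y : Fin m → ℝ => |(empirical y).real (Iic t) - p|) P
    rw [variance_eq_sub (X := fun y : Fin m → ℝ => |(empirical y).real (Iic t) - p|) hDL.abs] at h1
    have h2 : ∫ y, ((fun y : Fin m → ℝ => |(empirical y).real (Iic t) - p|) ^ 2) y ∂P =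
        p * (1 - p) / m := by
      simp only [Pi.pow_apply, sq_abs, hD, mul_pow]
      rw [integral_const_mul, hSv]
      field_simp
    rw [h2] at h1
    have : p * (1 - p) / m ≤ g / m := by gcongr
    linarith
  · refine ENNReal.ofReal_le_ofReal ?_
    have hZ : Integrable (fun y => |X y - p|) F :=
      ((hXL.sub (memLp_const p)).integrable (by norm_num)).abs
    have hZi : ∫ y, |X y - p| ∂F = 2 * (p * (1 - p)) := by
      -- Since `X` only takes the values `0` and `1`, `|X - p|` is affine in `X`.
      have : (fun y => |X y - p|) = fun y => X y * (1 - 2 * p) + p := by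
        ext y
        simp only [hX]
        split_ifs
        · rw [abs_of_nonneg (by linarith)]; ring
        · rw [zero_sub, abs_neg, abs_of_nonneg hp0]; ring
      rw [this, integral_add ((hXL.integrable (by norm_num)).mul_const _) (integrable_const _),
        integral_mul_const, hXi]
      simp; ring
    have hle (y : Fin m → ℝ) :
        |(empirical y).real (Iic t) - p| ≤ (m : ℝ)⁻¹ * ∑ i, |X (y i) - p| := by
      have : S y - m * p = ∑ i, (X (y i) - p) := by simp [S, Finset.sum_sub_distrib]
      rw [hD, this, abs_mul, abs_of_nonneg (by positivity)]
      gcongr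
      exact Finset.abs_sum_le_sum_abs _ _
    have hZP (i : Fin m) : Integrable (fun y : Fin m → ℝ => |X (y i) - p|) P :=
      (((hYL i).sub (memLp_const p)).integrable (by norm_num)).abs
    calc ∫ y, |(empirical y).real (Iic t) - p| ∂P
        ≤ ∫ y, (m : ℝ)⁻¹ * ∑ i, |X (y i) - p| ∂P :=
          integral_mono hDi ((integrable_finsetSum _ fun i _ => hZP i).const_mul _) hle
      _ = 2 * (p * (1 - p)) := by
          rw [integral_const_mul, integral_finsetSum _ fun i _ => hZP i]
          simp only [hYi (fun z => |X z - p|) (by fun_prop), hZi]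
          simp
          field_simp
      _ ≤ 2 * g := by gcongr

/-- Markov's inequality for the variance of the indicator of a half line. -/
lemma real_Iic_mul_one_sub_le {F : Measure ℝ} [IsProbabilityMeasure F] {α M : ℝ} (hα : 0 < α)
    (hM : 0 ≤ M) (hF : ∫⁻ x, ENNReal.ofReal (|x| ^ α) ∂F ≤ ENNReal.ofReal M) {t : ℝ} (ht : t ≠ 0) :
    F.real (Iic t) * (1 - F.real (Iic t)) ≤ M * |t| ^ (-α) := by
  have ht0 : 0 < |t| := abs_pos.2 ht
  have htα : 0 < |t| ^ α := Real.rpow_pos_of_pos ht0 α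
  have hp0 : 0 ≤ F.real (Iic t) := measureReal_nonneg
  have hp1 : F.real (Iic t) ≤ 1 := measureReal_le_one
  have hmarkov : F.real {x | |t| ≤ |x|} ≤ M * |t| ^ (-α) := by
    have h := mul_meas_ge_le_lintegral (μ := F) (f := fun x => ENNReal.ofReal (|x| ^ α))
      (by fun_prop) (ENNReal.ofReal (|t| ^ α))
    have hs : {x : ℝ | ENNReal.ofReal (|t| ^ α) ≤ ENNReal.ofReal (|x| ^ α)} =
        {x | |t| ≤ |x|} := by
      ext x
      simp only [mem_ofPred_eq]
      rw [ENNReal.ofReal_le_ofReal_iff (by positivity),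
        Real.rpow_le_rpow_iff ht0.le (abs_nonneg _) hα]
    rw [hs, ← ofReal_measureReal, ← ENNReal.ofReal_mul htα.le] at h
    have h' := (ENNReal.ofReal_le_ofReal_iff hM).1 (h.trans hF)
    rw [Real.rpow_neg ht0.le, ← div_eq_mul_inv, le_div_iff₀ htα]
    linarith
  -- The smaller tail is kept: `F(t)` for negative `t`, `1 - F(t)` for positive `t`. Either lies in
  -- the event `|t| ≤ |x|`.
  rcases lt_or_gt_of_ne ht with h | h
  · refine le_trans ?_ hmarkov
    calc F.real (Iic t) * (1 - F.real (Iic t)) ≤ F.real (Iic t) := by nlinarith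
      _ ≤ _ := measureReal_mono fun x (hx : x ≤ t) => by
          simp only [mem_ofPred_eq]
          rw [abs_of_neg h, abs_of_neg (hx.trans_lt h)]; linarith
  · refine le_trans ?_ hmarkov
    calc F.real (Iic t) * (1 - F.real (Iic t)) ≤ 1 - F.real (Iic t) := by nlinarith
      _ = F.real (Iic t)ᶜ := (probReal_compl_eq_one_sub measurableSet_Iic).symm
      _ ≤ _ := measureReal_mono fun x hx => by
          simp only [mem_compl_iff, mem_Iic, not_le, mem_ofPred_eq] at hx ⊢
          rw [abs_of_pos h, abs_of_pos (h.trans hx)]; exact hx.le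

lemma lintegral_comp_abs (f : ℝ → ℝ≥0∞) :
    ∫⁻ t, f |t| = 2 * ∫⁻ t in Ioi 0, f t := by
  have h1 : ∫⁻ t in Ioi (0 : ℝ), f |t| = ∫⁻ t in Ioi 0, f t :=
    setLIntegral_congr_fun measurableSet_Ioi fun t ht => by
      simp only [abs_of_pos (show 0 < t from ht)]
  have h2 : ∫⁻ t in Iio (0 : ℝ), f |t| = ∫⁻ t in Ioi (0 : ℝ), f |t| := by
    rw [← lintegral_indicator measurableSet_Iio, ← lintegral_indicator measurableSet_Ioi,
      ← lintegral_neg_eq_self]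
    refine lintegral_congr fun t => ?_
    by_cases h : 0 < t <;> simp [indicator, h]
  have h3 : ∫⁻ t in Iic (0 : ℝ), f |t| = ∫⁻ t in Iio (0 : ℝ), f |t| :=
    setLIntegral_congr Iio_ae_eq_Iic.symm
  rw [← lintegral_add_compl _ (measurableSet_Iic (a := (0 : ℝ))), compl_Iic, h3, h2, h1, two_mul]

lemma setLIntegral_Ioc_rpow {T s : ℝ} (hT : 0 ≤ T) (hs : -1 < s) :
    ∫⁻ t in Ioc 0 T, ENNReal.ofReal (t ^ s) = ENNReal.ofReal (T ^ (s + 1) / (s + 1)) := by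
  have hi : IntervalIntegrable (fun t : ℝ => t ^ s) volume 0 T :=
    intervalIntegral.intervalIntegrable_rpow' hs
  rw [← ofReal_integral_eq_lintegral_ofReal
      ((intervalIntegrable_iff_integrableOn_Ioc_of_le hT).1 hi),
    ← intervalIntegral.integral_of_le hT, integral_rpow (Or.inl hs),
    Real.zero_rpow (by linarith), sub_zero]
  filter_upwards [ae_restrict_mem measurableSet_Ioc] with t ht
  exact Real.rpow_nonneg ht.1.le _

lemma setLIntegral_Ioi_rpow {T s : ℝ} (hT : 0 < T) (hs : s < -1) :
    ∫⁻ t in Ioi T, ENNReal.ofReal (t ^ s) = ENNReal.ofReal (-T ^ (s + 1) / (s + 1)) := by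
  rw [← ofReal_integral_eq_lintegral_ofReal (integrableOn_Ioi_rpow_of_lt hs hT),
    integral_Ioi_rpow_of_lt hs hT]
  filter_upwards [ae_restrict_mem measurableSet_Ioi] with t ht
  exact Real.rpow_nonneg (hT.trans ht).le _

/-- The constant in the rate of convergence of empirical measures. -/
def rateConst (α M : ℝ) : ℝ := 2 * (√M / (1 - α / 2) + 2 * M / (α - 1))

lemma rateConst_nonneg {α M : ℝ} (hα1 : 1 < α) (hα2 : α < 2) (hM : 0 ≤ M) :
    0 ≤ rateConst α M := by
  have h1 : 0 < 1 - α / 2 := by linarith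
  have h2 : 0 < α - 1 := by linarith
  rw [rateConst]
  positivity

/-- The expected distance between a law with finite `α`th moment and the empirical measure of
an i.i.d. sample of size `m` is of order `m ^ (-1 + 1 / α)`. -/
lemma lintegral_cdfDist_empirical_le (hm : 1 ≤ m) (F : Measure ℝ) [IsProbabilityMeasure F]
    {α M : ℝ} (hα1 : 1 < α) (hα2 : α < 2) (hM : 0 ≤ M)
    (hF : ∫⁻ x, ENNReal.ofReal (|x| ^ α) ∂F ≤ ENNReal.ofReal M) :
    ∫⁻ y, cdfDist (empirical y) F ∂(Measure.pi fun _ : Fin m => F) ≤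
      ENNReal.ofReal (rateConst α M * (m : ℝ) ^ (-1 + 1 / α)) := by
  have hm0 : (0 : ℝ) < m := by exact_mod_cast hm
  have h1 : 0 < 1 - α / 2 := by linarith
  have h2 : 0 < α - 1 := by linarith
  -- At this cutoff `T^(-α) = 1/m`, so the two bounds `√(M s^(-α)/m)` and `2 M s^(-α)` have the same
  -- order in `m`.
  set T : ℝ := (m : ℝ) ^ (1 / α) with hT
  have hT0 : 0 < T := Real.rpow_pos_of_pos hm0 _
  set b : ℝ → ℝ≥0∞ := fun s => if s ≤ T then
      ENNReal.ofReal (√(M / m)) * ENNReal.ofReal (s ^ (-α / 2))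
    else ENNReal.ofReal (2 * M) * ENNReal.ofReal (s ^ (-α)) with hb
  have hfin : ∫⁻ y, cdfDist (empirical y) F ∂(Measure.pi fun _ : Fin m => F) ≤ ∫⁻ t, b |t| := by
    unfold cdfDist
    rw [lintegral_lintegral_swap (measurable_cdfDist_empirical_uncurry F).aemeasurable]
    refine lintegral_mono_ae ?_
    -- The origin is left out: `0 ^ (-α)` is `0` by default, so the Markov bound is not available
    -- there.
    filter_upwards [Measure.ae_ne volume (0 : ℝ)] with t ht
    have ht0 : 0 < |t| := abs_pos.2 ht
    have hkey := lintegral_empirical_real_Iic_sub_le hm F t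
      (real_Iic_mul_one_sub_le (by linarith) hM hF ht)
    simp only [hb]
    split_ifs
    · refine hkey.1.trans (le_of_eq ?_)
      rw [← ENNReal.ofReal_mul (Real.sqrt_nonneg _), mul_div_right_comm,
        Real.sqrt_mul (by positivity),
        Real.sqrt_eq_rpow (|t| ^ (-α)), ← Real.rpow_mul ht0.le]
      ring_nf
    · refine hkey.2.trans (le_of_eq ?_)
      rw [← ENNReal.ofReal_mul (by positivity), mul_assoc]
  refine hfin.trans (le_of_eq ?_)
  rw [lintegral_comp_abs, ← Ioc_union_Ioi_eq_Ioi hT0.le,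
    lintegral_union measurableSet_Ioi (Ioc_disjoint_Ioi le_rfl)]
  -- Integrability of `t^(-α/2)` at `0` needs `α < 2`; that of `t^(-α)` at infinity, used next,
  -- needs `α > 1`.
  have e1 : ∫⁻ t in Ioc 0 T, b t =
      ENNReal.ofReal (√(M / m) * (T ^ (1 - α / 2) / (1 - α / 2))) := by
    rw [setLIntegral_congr_fun (g := fun t => ENNReal.ofReal (√(M / m)) *
        ENNReal.ofReal (t ^ (-α / 2))) measurableSet_Ioc fun t ht => by simp [hb, ht.2],
      lintegral_const_mul _ (by fun_prop), setLIntegral_Ioc_rpow hT0.le (by linarith),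
      ← ENNReal.ofReal_mul (Real.sqrt_nonneg _)]
    ring_nf
  have e2 : ∫⁻ t in Ioi T, b t =
      ENNReal.ofReal (2 * M * (T ^ (1 - α) / (α - 1))) := by
    rw [setLIntegral_congr_fun (g := fun t => ENNReal.ofReal (2 * M) *
        ENNReal.ofReal (t ^ (-α))) measurableSet_Ioi fun t ht => by
          simp only [hb, if_neg (not_le.2 (show T < t from ht))],
      lintegral_const_mul _ (by fun_prop), setLIntegral_Ioi_rpow hT0 (by linarith),
      ← ENNReal.ofReal_mul (by positivity)]
    congr 2
    rw [show -α + 1 = -(α - 1) by ring, neg_div_neg_eq, show 1 - α = -(α - 1) by ring]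
  have e3 : √(M / m) * T ^ (1 - α / 2) = √M * (m : ℝ) ^ (-1 + 1 / α) := by
    rw [Real.sqrt_div hM, Real.sqrt_eq_rpow (m : ℝ), hT, ← Real.rpow_mul hm0.le, div_mul_eq_mul_div,
      mul_div_assoc, ← Real.rpow_sub hm0]
    congr 2
    field_simp
    ring
  have e4 : T ^ (1 - α) = (m : ℝ) ^ (-1 + 1 / α) := by
    rw [hT, ← Real.rpow_mul hm0.le]
    congr 1
    field_simp
    ring
  rw [e1, e2, ← ENNReal.ofReal_add (by positivity) (by positivity), ← ENNReal.ofReal_ofNat 2,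
    ← ENNReal.ofReal_mul (by norm_num), ← mul_div_assoc, e3, e4, rateConst]
  congr 1
  ring

end EmpiricalRate

/-! ### One level of the algorithm by coupling -/

section OneStep

variable {m : ℕ} {μ : Measure BranchVec}

/-- The extended-real version of `rho`. -/
def lrho (μ : Measure BranchVec) (γ : ℝ) : ℝ≥0∞ :=
  ∫⁻ v, ∑ i ∈ Finset.range (BranchVec.N v), ENNReal.ofReal (|BranchVec.C v i| ^ γ) ∂μ

/-- Used with `f` a coordinate of a coupling, and with `f` the lookup of a pool member at a random
position. -/
lemma map_step_comp [IsProbabilityMeasure μ] {Y : Type*} [MeasurableSpace Y]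
    (ν : Measure Y) [IsProbabilityMeasure ν] {f : Y → ℝ} (hf : Measurable f) :
    (μ.prod (Measure.infinitePi fun _ : ℕ => ν)).map (fun s => step s.1 fun r => f (s.2 r)) =
      smoothing μ (ν.map f) := by
  have hF : Measurable fun (w : ℕ → Y) (r : ℕ) => f (w r) := by fun_prop
  have h : μ.prod (Measure.infinitePi fun _ : ℕ => ν.map f) =
      (μ.prod (Measure.infinitePi fun _ : ℕ => ν)).map
        (Prod.map id fun (w : ℕ → Y) (r : ℕ) => f (w r)) := by
    rw [← Measure.map_prod_map _ _ measurable_id hF, Measure.map_id,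
      Measure.infinitePi_map_pi _ fun _ => hf]
  rw [smoothing, h, Measure.map_map measurable_step (measurable_id.prodMap hF)]
  rfl

lemma lintegral_eval_infinitePi {Y : Type*} [MeasurableSpace Y] (ν : Measure Y)
    [IsProbabilityMeasure ν] {f : Y → ℝ≥0∞} (hf : Measurable f) (r : ℕ) :
    ∫⁻ w, f (w r) ∂(Measure.infinitePi fun _ : ℕ => ν) = ∫⁻ y, f y ∂ν :=
  (measurePreserving_eval_infinitePi (fun _ : ℕ => ν) r).lintegral_comp hf

lemma measurable_step_comp {Y : Type*} [MeasurableSpace Y] {f : Y → ℝ} (hf : Measurable f) :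
    Measurable fun s : BranchVec × (ℕ → Y) => step s.1 fun r => f (s.2 r) :=
  measurable_step.comp (f := fun s : BranchVec × (ℕ → Y) => (s.1, fun r => f (s.2 r)))
    (measurable_fst.prodMk (by fun_prop))

/-- Smoothing contracts the cost of a coupling by the factor `ρ₁`. -/
lemma lintegral_abs_step_sub_step_le (π : Measure (ℝ × ℝ)) [IsProbabilityMeasure π] :
    ∫⁻ s, ENNReal.ofReal |(step s.1 fun r => (s.2 r).1) - step s.1 fun r => (s.2 r).2|
        ∂(μ.prod (Measure.infinitePi fun _ : ℕ => π)) ≤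
      lrho μ 1 * ∫⁻ p, ENNReal.ofReal |p.1 - p.2| ∂π := by
  have h1 := measurable_step_comp (Y := ℝ × ℝ) measurable_fst
  have h2 := measurable_step_comp (Y := ℝ × ℝ) measurable_snd
  rw [lintegral_prod _ (by fun_prop), lrho, ← lintegral_mul_const _
    (measurable_sum_range measurable_N fun i => by fun_prop)]
  refine lintegral_mono fun v => ?_
  calc ∫⁻ w, ENNReal.ofReal |(step v fun r => (w r).1) - step v fun r => (w r).2|
        ∂(Measure.infinitePi fun _ : ℕ => π)
      ≤ ∫⁻ w, ∑ r ∈ Finset.range (BranchVec.N v), ENNReal.ofReal |BranchVec.C v r| *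
          ENNReal.ofReal |(w r).1 - (w r).2| ∂(Measure.infinitePi fun _ : ℕ => π) := by
        refine lintegral_mono fun w => ?_
        simp only [← ENNReal.ofReal_mul (abs_nonneg _), ← abs_mul]
        rw [← ENNReal.ofReal_sum_of_nonneg fun _ _ => abs_nonneg _]
        refine ENNReal.ofReal_le_ofReal ?_
        rw [step, step, add_sub_add_right_eq_sub, ← Finset.sum_sub_distrib]
        simp only [← mul_sub]
        exact Finset.abs_sum_le_sum_abs _ _
    _ = _ := by
        rw [lintegral_finsetSum _ fun r _ => by fun_prop, Finset.sum_mul]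
        refine Finset.sum_congr rfl fun r _ => ?_
        rw [lintegral_const_mul _ (by fun_prop), lintegral_eval_infinitePi π
          (f := fun p => ENNReal.ofReal |p.1 - p.2|) (by fun_prop), Real.rpow_one]

/-- One level of the algorithm, started from the pool `x`: the pool of the next level is compared
with a coupled i.i.d. sample from `smoothing μ F`. -/
lemma lintegral_cdfDist_smoothing_le [IsProbabilityMeasure μ] (hm : 1 ≤ m)
    (F : Measure ℝ) [IsProbabilityMeasure F]
    (x : Fin m → ℝ) :
    ∫⁻ y, cdfDist (empirical y) (smoothing μ F)
        ∂(Measure.pi fun _ : Fin m => smoothing μ (empirical x)) ≤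
      lrho μ 1 * cdfDist (empirical x) F +
        ∫⁻ y, cdfDist (empirical y) (smoothing μ F)
          ∂(Measure.pi fun _ : Fin m => smoothing μ F) := by
  have := isProbabilityMeasure_empirical hm x
  obtain ⟨π, ⟨hπ0, hπ1, hπ2⟩, hcost⟩ := exists_mem_couplings_le_cdfDist (empirical x) F
  -- Both values `a` and `b` use the same branching vector and the two coordinates of the same
  -- coupled children, so `Q` cancels in `a - b`.
  set σ := μ.prod (Measure.infinitePi fun _ : ℕ => π) with hσ
  set a : BranchVec × (ℕ → ℝ × ℝ) → ℝ := fun s => step s.1 fun r => (s.2 r).1 with ha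
  set b : BranchVec × (ℕ → ℝ × ℝ) → ℝ := fun s => step s.1 fun r => (s.2 r).2 with hb
  have ham : Measurable a := measurable_step_comp measurable_fst
  have hbm : Measurable b := measurable_step_comp measurable_snd
  have hmap (c : BranchVec × (ℕ → ℝ × ℝ) → ℝ) (hc : Measurable c) :
      (Measure.pi fun _ : Fin m => σ).map (fun s i => c (s i)) =
        Measure.pi fun _ : Fin m => σ.map c := by
    have := Measure.isProbabilityMeasure_map (μ := σ) hc.aemeasurable
    exact Measure.pi_map_pi fun _ => hc.aemeasurable
  have hA : (Measure.pi fun _ : Fin m => smoothing μ (empirical x)) =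
      (Measure.pi fun _ : Fin m => σ).map fun s i => a (s i) := by
    rw [hmap a ham, ha, hσ, map_step_comp π measurable_fst, hπ1]
  have hB : (Measure.pi fun _ : Fin m => smoothing μ F) =
      (Measure.pi fun _ : Fin m => σ).map fun s i => b (s i) := by
    rw [hmap b hbm, hb, hσ, map_step_comp π measurable_snd, hπ2]
  have hW := measurable_cdfDist_empirical (m := m) (smoothing μ F)
  rw [hA, hB, lintegral_map hW (by fun_prop), lintegral_map hW (by fun_prop)]
  calc ∫⁻ s, cdfDist (empirical fun i => a (s i)) (smoothing μ F)
        ∂(Measure.pi fun _ : Fin m => σ)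
      ≤ ∫⁻ s, ((m : ℝ≥0∞)⁻¹ * ∑ i, ENNReal.ofReal |a (s i) - b (s i)| +
          cdfDist (empirical fun i => b (s i)) (smoothing μ F))
          ∂(Measure.pi fun _ : Fin m => σ) := by
        refine lintegral_mono fun s => ?_
        have := isProbabilityMeasure_empirical hm fun i => a (s i)
        have := isProbabilityMeasure_empirical hm fun i => b (s i)
        exact (cdfDist_triangle _ (empirical fun i => b (s i)) _).trans
          (add_le_add_left (cdfDist_empirical_le _ _) _)
    _ = (m : ℝ≥0∞)⁻¹ * ∑ _i : Fin m, ∫⁻ s, ENNReal.ofReal |a s - b s| ∂σ +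
          ∫⁻ s, cdfDist (empirical fun i => b (s i)) (smoothing μ F)
            ∂(Measure.pi fun _ : Fin m => σ) := by
        rw [lintegral_add_left (by fun_prop), lintegral_const_mul _ (by fun_prop),
          lintegral_finsetSum _ fun i _ => by fun_prop]
        congr 3
        ext i
        exact (measurePreserving_eval (fun _ : Fin m => σ) i).lintegral_comp
          (f := fun s => ENNReal.ofReal |a s - b s|) (by fun_prop)
    _ ≤ _ := by
        refine add_le_add_left ?_ _
        rw [Finset.sum_const, Finset.card_univ, Fintype.card_fin, nsmul_eq_mul, ← mul_assoc,
          ENNReal.inv_mul_cancel (by simp; lia) (ENNReal.natCast_ne_top m), one_mul]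
        exact (lintegral_abs_step_sub_step_le π).trans (mul_le_mul_right hcost _)

end OneStep

/-! ### Consequences of the moment conditions -/

section MomentConditions

variable {μ : Measure BranchVec}

lemma rpow_le_one_add_rpow {x γ β : ℝ} (hx : 0 ≤ x) (hγ : 0 ≤ γ) (hγβ : γ ≤ β) :
    x ^ γ ≤ 1 + x ^ β := by
  rcases le_total x 1 with h | h
  · have := Real.rpow_le_one hx h hγ
    have := Real.rpow_nonneg hx β
    linarith
  · have := Real.rpow_le_rpow_of_exponent_le h hγβ
    linarith

lemma integrable_rpow_of_le {A : Type*} [MeasurableSpace A] {P : Measure A} [IsFiniteMeasure P]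
    {g : A → ℝ} (hg : Measurable g) (hg0 : ∀ a, 0 ≤ g a) {γ β : ℝ} (hγ : 0 ≤ γ) (hγβ : γ ≤ β)
    (h : Integrable (fun a => g a ^ β) P) : Integrable (fun a => g a ^ γ) P := by
  refine ((integrable_const 1).add h).mono' (by fun_prop) (ae_of_all _ fun a => ?_)
  rw [Real.norm_of_nonneg (Real.rpow_nonneg (hg0 a) _)]
  exact rpow_le_one_add_rpow (hg0 a) hγ hγβ

/-- With `S` the sum, `c i ^ γ = c i * c i ^ (γ - 1) ≤ c i * S ^ (γ - 1)`. -/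
lemma sum_rpow_le_rpow_sum {ι : Type*} (s : Finset ι) {c : ι → ℝ} (hc : ∀ i, 0 ≤ c i) {γ : ℝ}
    (hγ : 1 ≤ γ) : ∑ i ∈ s, c i ^ γ ≤ (∑ i ∈ s, c i) ^ γ := by
  have hs : 0 ≤ ∑ i ∈ s, c i := Finset.sum_nonneg fun i _ => hc i
  have e (x : ℝ) (hx : 0 ≤ x) : x ^ γ = x * x ^ (γ - 1) := by
    rw [← Real.rpow_one_add' hx (by linarith)]; ring_nf
  rw [e _ hs, Finset.sum_mul]
  refine Finset.sum_le_sum fun i hi => ?_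
  rw [e _ (hc i)]
  exact mul_le_mul_of_nonneg_left (Real.rpow_le_rpow (hc i)
    (Finset.single_le_sum (fun j _ => hc j) hi) (by linarith)) (hc i)

lemma measurable_sum_abs_C :
    Measurable fun v => ∑ i ∈ Finset.range (BranchVec.N v), |BranchVec.C v i| :=
  measurable_sum_range measurable_N fun i => by fun_prop

lemma sum_abs_C_nonneg (v : BranchVec) :
    0 ≤ ∑ i ∈ Finset.range (BranchVec.N v), |BranchVec.C v i| :=
  Finset.sum_nonneg fun _ _ => abs_nonneg _

variable {β γ : ℝ}

lemma rho_nonneg : 0 ≤ rho μ γ :=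
  integral_nonneg fun _ => Finset.sum_nonneg fun _ _ => Real.rpow_nonneg (abs_nonneg _) _

variable [IsProbabilityMeasure μ]

lemma MomentConditions.integrable_sum_rpow (h : MomentConditions μ β) (hγ : 1 ≤ γ) (hγβ : γ ≤ β) :
    Integrable (fun v => ∑ i ∈ Finset.range (BranchVec.N v), |BranchVec.C v i| ^ γ) μ := by
  refine (integrable_rpow_of_le measurable_sum_abs_C sum_abs_C_nonneg (zero_le_one.trans hγ) hγβ
    h.moment_C).mono' (measurable_sum_range measurable_N fun i => by
      fun_prop).aestronglyMeasurable (ae_of_all _ fun v => ?_)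
  rw [Real.norm_of_nonneg (Finset.sum_nonneg fun _ _ => Real.rpow_nonneg (abs_nonneg _) _)]
  exact sum_rpow_le_rpow_sum _ (fun _ => abs_nonneg _) hγ

/-- The Bochner integral in `rho` would default to `0` without integrability, which the moment of
the total weight supplies for exponents between `1` and `β`. -/
lemma MomentConditions.lrho_eq (h : MomentConditions μ β) (hγ : 1 ≤ γ) (hγβ : γ ≤ β) :
    lrho μ γ = ENNReal.ofReal (rho μ γ) := by
  rw [lrho, rho, ofReal_integral_eq_lintegral_ofReal (h.integrable_sum_rpow hγ hγβ)
    (ae_of_all _ fun _ => Finset.sum_nonneg fun _ _ => Real.rpow_nonneg (abs_nonneg _) _)]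
  refine lintegral_congr fun v => ?_
  rw [ENNReal.ofReal_sum_of_nonneg fun _ _ => Real.rpow_nonneg (abs_nonneg _) _]

/-- `ρ` is bounded by a convex combination of its values at `1` and `β` in between. -/
lemma MomentConditions.rho_lt_one (h : MomentConditions μ β) (hβ : 1 < β)
    (h1 : max (rho μ 1) (rho μ β) < 1) (hγ : 1 ≤ γ) (hγβ : γ ≤ β) : rho μ γ < 1 := by
  -- The weight with `γ = θ · 1 + (1 - θ) · β`; weighted AM-GM for `c` and `c ^ β` then bounds `c ^
  -- γ` pointwise.
  set θ := (β - γ) / (β - 1) with hθ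
  have hb : 0 < β - 1 := by linarith
  have hθ0 : 0 ≤ θ := div_nonneg (by linarith) hb.le
  have hθ1 : 0 ≤ 1 - θ := by
    rw [hθ, sub_nonneg, div_le_one hb]; linarith
  have hcomb : θ + β * (1 - θ) = γ := by rw [hθ]; field_simp; ring
  have hpt (c : ℝ) (hc : 0 ≤ c) : c ^ γ ≤ θ * c ^ (1 : ℝ) + (1 - θ) * c ^ β := by
    have := Real.geom_mean_le_arith_mean2_weighted hθ0 hθ1 hc (Real.rpow_nonneg hc β) (by ring)
    rw [← Real.rpow_mul hc, ← Real.rpow_add_of_nonneg hc hθ0 (mul_nonneg (by linarith) hθ1),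
      hcomb] at this
    rwa [Real.rpow_one]
  have hle : rho μ γ ≤ θ * rho μ 1 + (1 - θ) * rho μ β := by
    have i1 := h.integrable_sum_rpow le_rfl hβ.le
    have i2 := h.integrable_sum_rpow hβ.le le_rfl
    rw [rho, rho, rho, ← integral_const_mul, ← integral_const_mul,
      ← integral_add (i1.const_mul _) (i2.const_mul _)]
    refine integral_mono (h.integrable_sum_rpow hγ hγβ) ((i1.const_mul _).add (i2.const_mul _))
      fun v => ?_
    simp only
    rw [Finset.mul_sum, Finset.mul_sum, ← Finset.sum_add_distrib]
    exact Finset.sum_le_sum fun i _ => hpt _ (abs_nonneg _)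
  set r := max (rho μ 1) (rho μ β)
  have e1 : θ * rho μ 1 ≤ θ * r := mul_le_mul_of_nonneg_left (le_max_left _ _) hθ0
  have e2 : (1 - θ) * rho μ β ≤ (1 - θ) * r := mul_le_mul_of_nonneg_left (le_max_right _ _) hθ1
  linarith

end MomentConditions

/-! ### Affine recursions -/

section Contraction

/-- The bound is a fixed point of `x ↦ r * x + b`, a monotone map, and it dominates the starting
value. -/
lemma le_mul_inv_of_affine_recursion {u : ℕ → ℝ≥0∞} {r b : ℝ≥0∞} (hr : r < 1) (h0 : u 0 ≤ b)
    (hs : ∀ k, u (k + 1) ≤ r * u k + b) (k : ℕ) : u k ≤ b * (1 - r)⁻¹ := by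
  have h1 : 1 - r ≠ 0 := (tsub_pos_of_lt hr).ne'
  have h2 : 1 - r ≠ ⊤ := ENNReal.sub_ne_top ENNReal.one_ne_top
  have hfix : r * (b * (1 - r)⁻¹) + b = b * (1 - r)⁻¹ := by
    nth_rewrite 2 [show b = (1 - r) * (b * (1 - r)⁻¹) by
      rw [mul_comm, mul_assoc, ENNReal.inv_mul_cancel h1 h2, mul_one]]
    rw [← add_mul, add_tsub_cancel_of_le hr.le, one_mul]
  induction k with
  | zero => exact h0.trans (by rw [← hfix]; exact le_add_self)
  | succ k ih =>
    rw [← hfix]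
    exact (hs k).trans (add_le_add_left (mul_le_mul_right ih _) _)

lemma mul_inv_one_sub_lt_top {r b : ℝ≥0∞} (hr : r < 1) (hb : b < ⊤) : b * (1 - r)⁻¹ < ⊤ :=
  ENNReal.mul_lt_top hb (ENNReal.inv_lt_top.2 (tsub_pos_of_lt hr))

end Contraction

/-! ### Moments of order between one and two under smoothing -/

section SubquadraticMoments

/-- Jensen's inequality for a concave power, read off from the monotonicity of `Lᵖ` norms on a
probability space. -/
lemma lintegral_rpow_le_rpow_lintegral {A : Type*} [MeasurableSpace A] {P : Measure A}
    [IsProbabilityMeasure P] {g : A → ℝ≥0∞} (hg : Measurable g) {a : ℝ} (ha0 : 0 < a)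
    (ha1 : a ≤ 1) : ∫⁻ x, g x ^ a ∂P ≤ (∫⁻ x, g x ∂P) ^ a := by
  have h := eLpNorm'_le_eLpNorm'_of_exponent_le (f := g) ha0 ha1 P hg.aestronglyMeasurable
  simp only [eLpNorm', enorm_eq_self, ENNReal.rpow_one, div_one] at h
  have h' := ENNReal.rpow_le_rpow h ha0.le
  rwa [← ENNReal.rpow_mul, one_div, inv_mul_cancel₀ ha0.ne', ENNReal.rpow_one] at h'

/-- A moment of order `1 + a ≤ 2` of a weighted sum of i.i.d. nonnegative random variables
exceeds the `(1 + a)`th power of the mean by at most the sum of the individual moments. -/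
lemma lintegral_add_sum_rpow_le (ν : Measure ℝ) [IsProbabilityMeasure ν] {f : ℝ → ℝ≥0∞}
    (hf : Measurable f) (q : ℝ≥0∞) (n : ℕ) (c : ℕ → ℝ≥0∞) {a : ℝ} (ha0 : 0 < a) (ha1 : a ≤ 1) :
    ∫⁻ w, (q + ∑ r ∈ Finset.range n, c r * f (w r)) ^ (1 + a)
        ∂(Measure.infinitePi fun _ : ℕ => ν) ≤
      (∑ r ∈ Finset.range n, c r ^ (1 + a)) * ∫⁻ x, f x ^ (1 + a) ∂ν +
        (q + (∑ r ∈ Finset.range n, c r) * ∫⁻ x, f x ∂ν) ^ (1 + a) := by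
  set P := Measure.infinitePi fun _ : ℕ => ν
  set e := ∫⁻ x, f x ∂ν
  set Y : ℕ → (ℕ → ℝ) → ℝ≥0∞ := fun r w => c r * f (w r) with hY
  have hYm (r : ℕ) : Measurable (Y r) := by fun_prop
  have hSm (s : Finset ℕ) : Measurable fun w => q + ∑ r ∈ s, Y r w := by fun_prop
  have hYi (r : ℕ) : ∫⁻ w, Y r w ∂P = c r * e := by
    rw [hY, lintegral_const_mul _ (by fun_prop), lintegral_eval_infinitePi ν hf]
  have hS (s : Finset ℕ) (hs : s ⊆ Finset.range n) :
      ∫⁻ w, (q + ∑ r ∈ s, Y r w) ^ a ∂P ≤ (q + (∑ r ∈ Finset.range n, c r) * e) ^ a := by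
    refine (lintegral_rpow_le_rpow_lintegral (hSm s) ha0 ha1).trans
      (ENNReal.rpow_le_rpow ?_ ha0.le)
    rw [lintegral_add_left measurable_const, lintegral_const, measure_univ, mul_one,
      lintegral_finsetSum _ fun r _ => hYm r, Finset.sum_mul]
    simp only [hYi]
    gcongr
  have hind (r : ℕ) (s : Finset ℕ) (hr : r ∉ s) :
      ∫⁻ w, Y r w * (q + ∑ j ∈ s, Y j w) ^ a ∂P =
        (∫⁻ w, Y r w ∂P) * ∫⁻ w, (q + ∑ j ∈ s, Y j w) ^ a ∂P := by
    have h1 : iIndepFun Y P :=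
      iIndepFun_infinitePi (X := fun r x => c r * f x) fun r => by fun_prop
    have h2 := (h1.indepFun_finsetSum_of_notMem hYm hr).symm.comp measurable_id
      (show Measurable fun z : ℝ≥0∞ => (q + z) ^ a by fun_prop)
    have h3 : (fun z : ℝ≥0∞ => (q + z) ^ a) ∘ (∑ j ∈ s, Y j) =
        fun w => (q + ∑ j ∈ s, Y j w) ^ a := by
      ext w; simp
    rw [h3] at h2
    exact lintegral_mul_eq_lintegral_mul_lintegral_of_indepFun (hYm r)
      ((hSm s).pow_const a) h2
  have hpow (x : ℝ≥0∞) : x ^ (1 + a) = x * x ^ a := by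
    rw [ENNReal.rpow_add_of_nonneg _ _ zero_le_one ha0.le, ENNReal.rpow_one]
  -- One factor of `S^(1+a) = S · S^a` is expanded. Subadditivity of `x ↦ x^a` then separates `Y r`
  -- from the remaining terms, which are independent of it; Jensen's inequality bounds the `a`th
  -- moment of those.
  have hpt (w : ℕ → ℝ) : (q + ∑ r ∈ Finset.range n, Y r w) ^ (1 + a) ≤
      q * (q + ∑ r ∈ Finset.range n, Y r w) ^ a + ∑ r ∈ Finset.range n,
        (Y r w ^ (1 + a) + Y r w * (q + ∑ j ∈ (Finset.range n).erase r, Y j w) ^ a) := by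
    rw [hpow, add_mul, Finset.sum_mul]
    gcongr with r hr
    rw [hpow, ← mul_add]
    gcongr
    rw [← Finset.add_sum_erase _ _ hr, add_left_comm]
    exact ENNReal.rpow_add_le_add_rpow _ _ ha0.le ha1
  calc _ ≤ _ := lintegral_mono hpt
    _ = q * ∫⁻ w, (q + ∑ r ∈ Finset.range n, Y r w) ^ a ∂P + ∑ r ∈ Finset.range n,
          (c r ^ (1 + a) * ∫⁻ x, f x ^ (1 + a) ∂ν + c r * e *
            ∫⁻ w, (q + ∑ j ∈ (Finset.range n).erase r, Y j w) ^ a ∂P) := by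
        rw [lintegral_add_left (((hSm _).pow_const a).const_mul q),
          lintegral_const_mul _ ((hSm _).pow_const a), lintegral_finsetSum _ fun r _ => by fun_prop]
        congr 1
        refine Finset.sum_congr rfl fun r _ => ?_
        rw [lintegral_add_left ((hYm r).pow_const _), hind r _ (Finset.notMem_erase _ _), hYi]
        congr 1
        simp only [hY, ENNReal.mul_rpow_of_nonneg _ _ (show 0 ≤ 1 + a by linarith)]
        rw [lintegral_const_mul _ (by fun_prop),
          lintegral_eval_infinitePi ν (f := fun x => f x ^ (1 + a)) (by fun_prop)]
    _ ≤ q * (q + (∑ r ∈ Finset.range n, c r) * e) ^ a + ∑ r ∈ Finset.range n,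
          (c r ^ (1 + a) * ∫⁻ x, f x ^ (1 + a) ∂ν + c r * e *
            (q + (∑ r ∈ Finset.range n, c r) * e) ^ a) := by
        gcongr with r hr
        · exact hS _ subset_rfl
        · exact hS _ (Finset.erase_subset _ _)
    _ = _ := by
        rw [Finset.sum_add_distrib, ← Finset.sum_mul, ← Finset.sum_mul, ← Finset.sum_mul,
          hpow (q + _)]
        ring

variable {μ : Measure BranchVec}

lemma lintegral_smoothing [IsProbabilityMeasure μ] (ν : Measure ℝ) [IsProbabilityMeasure ν]
    {f : ℝ → ℝ≥0∞} (hf : Measurable f) :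
    ∫⁻ x, f x ∂(smoothing μ ν) =
      ∫⁻ v, ∫⁻ w, f (step v w) ∂(Measure.infinitePi fun _ : ℕ => ν) ∂μ := by
  rw [smoothing, lintegral_map hf measurable_step,
    lintegral_prod (fun p => f (step p.1 p.2)) (hf.comp measurable_step).aemeasurable]

lemma ofReal_abs_step_le (v : BranchVec) (w : ℕ → ℝ) :
    ENNReal.ofReal |step v w| ≤ ENNReal.ofReal |BranchVec.Q v| +
      ∑ r ∈ Finset.range (BranchVec.N v),
        ENNReal.ofReal |BranchVec.C v r| * ENNReal.ofReal |w r| := by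
  simp only [← ENNReal.ofReal_mul (abs_nonneg _), ← abs_mul]
  rw [← ENNReal.ofReal_sum_of_nonneg fun _ _ => abs_nonneg _,
    ← ENNReal.ofReal_add (abs_nonneg _) (Finset.sum_nonneg fun _ _ => abs_nonneg _)]
  refine ENNReal.ofReal_le_ofReal ?_
  rw [step, add_comm]
  exact (abs_add_le _ _).trans (add_le_add_right (Finset.abs_sum_le_sum_abs _ _) _)

lemma lintegral_abs_smoothing_le [IsProbabilityMeasure μ] (ν : Measure ℝ)
    [IsProbabilityMeasure ν] :
    ∫⁻ x, ENNReal.ofReal |x| ∂(smoothing μ ν) ≤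
      lrho μ 1 * ∫⁻ x, ENNReal.ofReal |x| ∂ν + ∫⁻ v, ENNReal.ofReal |BranchVec.Q v| ∂μ := by
  rw [lintegral_smoothing ν (by fun_prop), lrho, ← lintegral_mul_const _
    (measurable_sum_range measurable_N fun i => by fun_prop), ← lintegral_add_right _ (by fun_prop)]
  refine lintegral_mono fun v => (lintegral_mono (ofReal_abs_step_le v)).trans (le_of_eq ?_)
  rw [lintegral_add_left measurable_const, lintegral_const, measure_univ, mul_one, add_comm,
    lintegral_finsetSum _ fun r _ => by fun_prop, Finset.sum_mul]
  congr 1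
  refine Finset.sum_congr rfl fun r _ => ?_
  rw [lintegral_const_mul _ (by fun_prop), lintegral_eval_infinitePi ν
    (f := fun x => ENNReal.ofReal |x|) (by fun_prop), Real.rpow_one]

/-- Conditionally on the branching vector, the previous moments of order `α` enter only through the
factor `lrho μ α`; the remainder needs only the first-moment bound `E`. -/
lemma lintegral_abs_rpow_smoothing_le [IsProbabilityMeasure μ] (ν : Measure ℝ)
    [IsProbabilityMeasure ν] {α : ℝ} (hα1 : 1 < α) (hα2 : α ≤ 2) {E : ℝ≥0∞}
    (hE : ∫⁻ x, ENNReal.ofReal |x| ∂ν ≤ E) :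
    ∫⁻ x, ENNReal.ofReal |x| ^ α ∂(smoothing μ ν) ≤
      lrho μ α * ∫⁻ x, ENNReal.ofReal |x| ^ α ∂ν +
        ∫⁻ v, (ENNReal.ofReal |BranchVec.Q v| + ENNReal.ofReal
          (∑ i ∈ Finset.range (BranchVec.N v), |BranchVec.C v i|) * E) ^ α ∂μ := by
  have hm := measurable_sum_abs_C
  rw [lintegral_smoothing ν (by fun_prop), lrho, ← lintegral_mul_const _
    (measurable_sum_range measurable_N fun i => by fun_prop), ← lintegral_add_right _ (by fun_prop)]
  refine lintegral_mono fun v => ?_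
  have h := lintegral_add_sum_rpow_le ν (f := fun x => ENNReal.ofReal |x|) (by fun_prop)
    (ENNReal.ofReal |BranchVec.Q v|) (BranchVec.N v) (fun r => ENNReal.ofReal |BranchVec.C v r|)
    (a := α - 1) (by linarith) (by linarith)
  rw [add_sub_cancel] at h
  refine (lintegral_mono fun w =>
    ENNReal.rpow_le_rpow (ofReal_abs_step_le v w) (by linarith)).trans (h.trans ?_)
  simp only [ENNReal.ofReal_rpow_of_nonneg (abs_nonneg _) (show 0 ≤ α by linarith)]
  rw [ENNReal.ofReal_sum_of_nonneg fun _ _ => abs_nonneg _]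
  gcongr

end SubquadraticMoments

/-! ### Moment bounds uniform in `k` -/

section UniformMoments

variable {μ : Measure BranchVec} {β α : ℝ}

lemma lintegral_lawR_zero {f : ℝ → ℝ≥0∞} (hf : Measurable f) :
    ∫⁻ x, f x ∂(lawR μ 0) = ∫⁻ v, f (BranchVec.Q v) ∂μ :=
  lintegral_map hf measurable_Q

variable [IsProbabilityMeasure μ]

lemma MomentConditions.integrable_abs_Q_rpow (h : MomentConditions μ β) {γ : ℝ} (hγ : 0 ≤ γ)
    (hγβ : γ ≤ β) : Integrable (fun v => |BranchVec.Q v| ^ γ) μ :=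
  integrable_rpow_of_le (by fun_prop) (fun _ => abs_nonneg _) hγ hγβ h.moment_Q

/-- Two contractions in succession: first moments with ratio `ρ₁`, whose bound `E` is the input for
the `α`th moments with ratio `ρ_α`. -/
lemma MomentConditions.exists_moment_bound_of_max_lt (h : MomentConditions μ β) (hβ : 1 < β)
    (h1 : max (rho μ 1) (rho μ β) < 1) (hα1 : 1 < α) (hα2 : α < 2) (hαβ : α ≤ β) :
    ∃ B < ⊤, ∀ k, ∫⁻ x, ENNReal.ofReal (|x| ^ α) ∂(lawR μ k) ≤ B := by
  have hα0 : 0 ≤ α := by linarith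
  have hr1 : lrho μ 1 < 1 := by
    rw [h.lrho_eq le_rfl hβ.le, ENNReal.ofReal_lt_one]
    exact (le_max_left _ _).trans_lt h1
  have hrα : lrho μ α < 1 := by
    rw [h.lrho_eq hα1.le hαβ, ENNReal.ofReal_lt_one]
    exact h.rho_lt_one hβ h1 hα1.le hαβ
  have hQ1 : ∫⁻ v, ENNReal.ofReal |BranchVec.Q v| ∂μ < ⊤ := by
    have := (h.integrable_abs_Q_rpow zero_le_one hβ.le).lintegral_lt_top
    simpa using this
  set E := (∫⁻ v, ENNReal.ofReal |BranchVec.Q v| ∂μ) * (1 - lrho μ 1)⁻¹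
  have hE : E < ⊤ := mul_inv_one_sub_lt_top hr1 hQ1
  have hEk (k : ℕ) : ∫⁻ x, ENNReal.ofReal |x| ∂(lawR μ k) ≤ E :=
    le_mul_inv_of_affine_recursion (u := fun k => ∫⁻ x, ENNReal.ofReal |x| ∂(lawR μ k)) hr1
      (lintegral_lawR_zero (by fun_prop)).le (fun k => lintegral_abs_smoothing_le (lawR μ k)) k
  set b := ∫⁻ v, (ENNReal.ofReal |BranchVec.Q v| + ENNReal.ofReal
    (∑ i ∈ Finset.range (BranchVec.N v), |BranchVec.C v i|) * E) ^ α ∂μ with hb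
  have hbtop : b < ⊤ := by
    have hm := measurable_sum_abs_C
    refine (lintegral_mono fun v =>
      ENNReal.rpow_add_le_mul_rpow_add_rpow _ _ hα1.le).trans_lt ?_
    rw [lintegral_const_mul _ (by fun_prop), lintegral_add_left (by fun_prop)]
    refine ENNReal.mul_lt_top (ENNReal.rpow_lt_top_of_nonneg (by linarith) (by simp))
      (ENNReal.add_lt_top.2 ⟨?_, ?_⟩)
    · have := (h.integrable_abs_Q_rpow hα0 hαβ).lintegral_lt_top
      simpa only [ENNReal.ofReal_rpow_of_nonneg (abs_nonneg _) hα0] using this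
    · simp only [ENNReal.mul_rpow_of_nonneg _ _ hα0]
      rw [lintegral_mul_const _ (by fun_prop)]
      refine ENNReal.mul_lt_top ?_ (ENNReal.rpow_lt_top_of_nonneg hα0 hE.ne)
      have := (integrable_rpow_of_le measurable_sum_abs_C sum_abs_C_nonneg hα0 hαβ
        h.moment_C).lintegral_lt_top
      simpa only [ENNReal.ofReal_rpow_of_nonneg (sum_abs_C_nonneg _) hα0] using this
  refine ⟨b * (1 - lrho μ α)⁻¹, mul_inv_one_sub_lt_top hrα hbtop, ?_⟩
  simp only [← ENNReal.ofReal_rpow_of_nonneg (abs_nonneg _) hα0]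
  refine le_mul_inv_of_affine_recursion hrα ?_ fun k => ?_
  · rw [lintegral_lawR_zero (by fun_prop)]
    exact lintegral_mono fun v => ENNReal.rpow_le_rpow le_self_add hα0
  · exact lintegral_abs_rpow_smoothing_le (lawR μ k) hα1 hα2.le (hEk k)

lemma memLp_two_iff_lintegral_lt_top {F : Measure ℝ} :
    MemLp (fun x : ℝ => x) 2 F ↔ ∫⁻ x, ENNReal.ofReal (x ^ 2) ∂F < ⊤ := by
  rw [memLp_two_iff_integrable_sq (by fun_prop)]
  refine ⟨fun h => h.lintegral_lt_top, fun h => ⟨by fun_prop, ?_⟩⟩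
  rw [hasFiniteIntegral_iff_ofReal (ae_of_all _ fun x => sq_nonneg x)]
  exact h

/-- Mean and second moment of `∑ C_r X_r + Q` for fixed weights and i.i.d. centred `X_r`. -/
lemma integral_step_of_centered {F : Measure ℝ} [IsProbabilityMeasure F]
    (hF : MemLp (fun x : ℝ => x) 2 F) (h0 : ∫ x, x ∂F = 0) (v : BranchVec) :
    ∫ w, step v w ∂(Measure.infinitePi fun _ : ℕ => F) = BranchVec.Q v ∧
    ∫⁻ w, ENNReal.ofReal (step v w ^ 2) ∂(Measure.infinitePi fun _ : ℕ => F) =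
      (∑ r ∈ Finset.range (BranchVec.N v), ENNReal.ofReal (|BranchVec.C v r| ^ (2 : ℝ))) *
        ∫⁻ x, ENNReal.ofReal (x ^ 2) ∂F + ENNReal.ofReal (BranchVec.Q v ^ 2) := by
  set P := Measure.infinitePi fun _ : ℕ => F
  set Y : ℕ → (ℕ → ℝ) → ℝ := fun r w => BranchVec.C v r * w r with hY
  have hev (r : ℕ) := measurePreserving_eval_infinitePi (fun _ : ℕ => F) r
  have hXL (r : ℕ) : MemLp (fun w : ℕ → ℝ => w r) 2 P := hF.comp_measurePreserving (hev r)
  have hYL (r : ℕ) : MemLp (Y r) 2 P := (hXL r).const_mul _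
  have hXi (r : ℕ) : ∫ w, w r ∂P = 0 := by
    rw [← h0, ← (hev r).map_eq, integral_map (hev r).measurable.aemeasurable (by fun_prop)]
  have hXv (r : ℕ) : Var[fun w : ℕ → ℝ => w r; P] = ∫ x, x ^ 2 ∂F := by
    rw [variance_of_integral_eq_zero (hXL r).aemeasurable (hXi r)]
    conv_rhs => rw [← (hev r).map_eq, integral_map (hev r).measurable.aemeasurable (by fun_prop)]
  have hind : iIndepFun Y P :=
    iIndepFun_infinitePi (X := fun r x => BranchVec.C v r * x) fun r => by fun_prop
  set S : (ℕ → ℝ) → ℝ := ∑ r ∈ Finset.range (BranchVec.N v), Y r with hS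
  have hSL : MemLp S 2 P := memLp_finsetSum' _ fun r _ => hYL r
  have hstep : step v = fun w => S w + BranchVec.Q v := by
    ext w; simp [step, hS, hY]
  have hSi : ∫ w, S w ∂P = 0 := by
    simp only [hS, Finset.sum_apply]
    rw [integral_finsetSum _ fun r _ => (hYL r).integrable (by norm_num)]
    refine Finset.sum_eq_zero fun r _ => ?_
    rw [hY, integral_const_mul, hXi, mul_zero]
  have hSint : Integrable S P := hSL.integrable (by norm_num)
  have hSv : ∫ w, S w ^ 2 ∂P =
      (∑ r ∈ Finset.range (BranchVec.N v), |BranchVec.C v r| ^ (2 : ℝ)) * ∫ x, x ^ 2 ∂F := by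
    rw [← variance_of_integral_eq_zero hSL.aemeasurable hSi, hS,
      IndepFun.variance_sum (fun r _ => hYL r) fun i _ j _ hij => hind.indepFun hij, Finset.sum_mul]
    refine Finset.sum_congr rfl fun r _ => ?_
    rw [hY, variance_const_mul, hXv, Real.rpow_two, sq_abs]
  have hstepL : MemLp (step v) 2 P := by rw [hstep]; exact hSL.add (memLp_const _)
  have hc : 0 ≤ ∑ r ∈ Finset.range (BranchVec.N v), |BranchVec.C v r| ^ (2 : ℝ) :=
    Finset.sum_nonneg fun _ _ => Real.rpow_nonneg (abs_nonneg _) _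
  constructor
  · rw [hstep, integral_add hSint (integrable_const _), hSi]
    simp
  · rw [← ofReal_integral_eq_lintegral_ofReal hstepL.integrable_sq
        (ae_of_all _ fun _ => sq_nonneg _),
      ← ofReal_integral_eq_lintegral_ofReal hF.integrable_sq (ae_of_all _ fun _ => sq_nonneg _),
      ← ENNReal.ofReal_sum_of_nonneg fun _ _ => Real.rpow_nonneg (abs_nonneg _) _,
      ← ENNReal.ofReal_mul hc, ← ENNReal.ofReal_add (mul_nonneg hc
        (integral_nonneg fun _ => sq_nonneg _)) (sq_nonneg _), ← hSv]
    congr 1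
    -- The cross term `2 Q S` integrates to zero because `S` is centred.
    have : (fun w => step v w ^ 2) =
        fun w => S w ^ 2 + (2 * BranchVec.Q v * S w + BranchVec.Q v ^ 2) := by
      ext w; rw [hstep]; ring
    have hlin : Integrable (fun w => 2 * BranchVec.Q v * S w + BranchVec.Q v ^ 2) P :=
      (hSint.const_mul _).add (integrable_const _)
    rw [this, integral_add hSL.integrable_sq hlin,
      integral_add (hSint.const_mul _) (integrable_const _), integral_const_mul, hSi]
    simp

lemma lintegral_sq_smoothing_of_centered {F : Measure ℝ} [IsProbabilityMeasure F]
    (hF : MemLp (fun x : ℝ => x) 2 F) (h0 : ∫ x, x ∂F = 0) :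
    ∫⁻ x, ENNReal.ofReal (x ^ 2) ∂(smoothing μ F) =
      lrho μ 2 * ∫⁻ x, ENNReal.ofReal (x ^ 2) ∂F +
        ∫⁻ v, ENNReal.ofReal (BranchVec.Q v ^ 2) ∂μ := by
  rw [lintegral_smoothing F (by fun_prop), lrho, ← lintegral_mul_const _
    (measurable_sum_range measurable_N fun i => by fun_prop), ← lintegral_add_right _ (by fun_prop)]
  exact lintegral_congr fun v => (integral_step_of_centered hF h0 v).2

lemma integral_smoothing_of_centered {F : Measure ℝ} [IsProbabilityMeasure F]
    (hF : MemLp (fun x : ℝ => x) 2 F) (h0 : ∫ x, x ∂F = 0)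
    (hs : MemLp (fun x : ℝ => x) 2 (smoothing μ F)) :
    ∫ x, x ∂(smoothing μ F) = ∫ v, BranchVec.Q v ∂μ := by
  have hi : Integrable (fun p : BranchVec × (ℕ → ℝ) => step p.1 p.2)
      (μ.prod (Measure.infinitePi fun _ : ℕ => F)) :=
    (integrable_map_measure (by fun_prop) measurable_step.aemeasurable).1
      (hs.integrable (by norm_num))
  rw [smoothing, integral_map measurable_step.aemeasurable (by fun_prop), integral_prod _ hi]
  exact integral_congr_ae (ae_of_all _ fun v => (integral_step_of_centered hF h0 v).1)

/-- Replaces first-moment contraction, unavailable when `ρ₁ = 1`: centring is preserved by smoothing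
when `E[Q] = 0`, so second moments obey an exact affine recursion of ratio `ρ₂`. -/
lemma MomentConditions.exists_moment_bound_of_centered (h : MomentConditions μ 2)
    (h2 : rho μ 2 < 1) (hQ : ∫ v, BranchVec.Q v ∂μ = 0) (hα1 : 1 < α) (hα2 : α < 2) :
    ∃ B < ⊤, ∀ k, ∫⁻ x, ENNReal.ofReal (|x| ^ α) ∂(lawR μ k) ≤ B := by
  have hr : lrho μ 2 < 1 := by
    rw [h.lrho_eq one_le_two le_rfl, ENNReal.ofReal_lt_one]; exact h2
  set b := ∫⁻ v, ENNReal.ofReal (BranchVec.Q v ^ 2) ∂μ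
  have hb : b < ⊤ := by
    have := h.moment_Q.lintegral_lt_top
    simpa only [Real.rpow_two, sq_abs] using this
  -- Finiteness and centring are carried together, since each recursion step needs both.
  have hstep (k : ℕ) : MemLp (fun x : ℝ => x) 2 (lawR μ k) ∧ ∫ x, x ∂(lawR μ k) = 0 := by
    induction k with
    | zero =>
      refine ⟨memLp_two_iff_lintegral_lt_top.2 ?_, ?_⟩
      · rw [lintegral_lawR_zero (by fun_prop)]; exact hb
      · rw [lawR, integral_map measurable_Q.aemeasurable (by fun_prop), hQ]
    | succ k ih =>
      have hL : MemLp (fun x : ℝ => x) 2 (smoothing μ (lawR μ k)) := by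
        rw [memLp_two_iff_lintegral_lt_top, lintegral_sq_smoothing_of_centered ih.1 ih.2]
        exact ENNReal.add_lt_top.2 ⟨ENNReal.mul_lt_top (hr.trans ENNReal.one_lt_top)
          (memLp_two_iff_lintegral_lt_top.1 ih.1), hb⟩
      exact ⟨hL, (integral_smoothing_of_centered ih.1 ih.2 hL).trans hQ⟩
  have hk := le_mul_inv_of_affine_recursion
    (u := fun k => ∫⁻ x, ENNReal.ofReal (x ^ 2) ∂(lawR μ k)) hr
    (lintegral_lawR_zero (by fun_prop)).le
    fun k => (lintegral_sq_smoothing_of_centered (hstep k).1 (hstep k).2).le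
  refine ⟨1 + b * (1 - lrho μ 2)⁻¹, ENNReal.add_lt_top.2 ⟨ENNReal.one_lt_top,
    mul_inv_one_sub_lt_top hr hb⟩, fun k => ?_⟩
  calc ∫⁻ x, ENNReal.ofReal (|x| ^ α) ∂(lawR μ k)
      ≤ ∫⁻ x, (1 + ENNReal.ofReal (x ^ 2)) ∂(lawR μ k) := by
        refine lintegral_mono fun x => ?_
        rw [← ENNReal.ofReal_one, ← ENNReal.ofReal_add zero_le_one (sq_nonneg _)]
        refine ENNReal.ofReal_le_ofReal ?_
        have := rpow_le_one_add_rpow (abs_nonneg x) (by linarith) hα2.le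
        rwa [Real.rpow_two, sq_abs] at this
    _ ≤ _ := by
        rw [lintegral_add_left measurable_const, lintegral_const, measure_univ, mul_one]
        exact add_le_add_right (hk k) _

/-- The laws of `R^{(k)}` have uniformly bounded `α`th moments. -/
lemma MomentConditions.exists_moment_bound (h : MomentConditions μ β) (hβ : 1 < β) (hα1 : 1 < α)
    (hα2 : α < 2) (hαβ : α ≤ β) :
    ∃ M : ℝ, 0 ≤ M ∧ ∀ k, ∫⁻ x, ENNReal.ofReal (|x| ^ α) ∂(lawR μ k) ≤ ENNReal.ofReal M := by
  obtain ⟨B, hB, hk⟩ : ∃ B < ⊤, ∀ k, ∫⁻ x, ENNReal.ofReal (|x| ^ α) ∂(lawR μ k) ≤ B := by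
    rcases h.contraction with h1 | ⟨rfl, _, h2, hQ⟩
    · exact h.exists_moment_bound_of_max_lt hβ h1 hα1 hα2 hαβ
    · exact h.exists_moment_bound_of_centered h2 hQ hα1 hα2
  exact ⟨B.toReal, ENNReal.toReal_nonneg, by simpa [ENNReal.ofReal_toReal hB.ne] using hk⟩

end UniformMoments

/-! ### Iterating over the levels of the algorithm -/

section Pool

variable {Ω : Type*} {m : ℕ}

/-- The pool that follows the pool `x`, computed from the branching vectors `v` and the
positions `s`. -/
def nextPool (x : Fin m → ℝ) (v : Fin m → BranchVec) (s : Fin m → ℕ → Fin m) : Fin m → ℝ :=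
  fun i => step (v i) fun r => x (s i r)

/-- The pool at level `j` as a function of the initial pool and of the random input. -/
def poolFun (j : ℕ) (x : Fin m → ℝ) (v : ℕ → Fin m → BranchVec)
    (s : ℕ → Fin m → ℕ → Fin m) : Fin m → ℝ :=
  match j with
  | 0 => x
  | j + 1 => nextPool (poolFun j x v s) (v j) (s j)

lemma pool_eq_poolFun (Q₀ : Fin m → Ω → ℝ) (V : ℕ → Fin m → Ω → BranchVec)
    (I : ℕ → Fin m → ℕ → Ω → Fin m) (j : ℕ) (ω : Ω) :
    pool Q₀ V I j ω = poolFun j (fun i => Q₀ i ω) (fun j i => V j i ω) fun j i r => I j i r ω := by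
  induction j with
  | zero => rfl
  | succ j ih => ext i; simp only [pool, poolFun, nextPool, step, ih]

/-- `poolFun` unfolds at the last level; the estimate peels off the first one, so that it always
starts from a deterministic pool. -/
lemma poolFun_succ' (j : ℕ) (x : Fin m → ℝ) (v : ℕ → Fin m → BranchVec)
    (s : ℕ → Fin m → ℕ → Fin m) :
    poolFun (j + 1) x v s =
      poolFun j (nextPool x (v 0) (s 0)) (fun j => v (j + 1)) fun j => s (j + 1) := by
  induction j with
  | zero => rfl
  | succ j ih => rw [poolFun, ih]; rfl

lemma measurable_nextPool {A : Type*} [MeasurableSpace A] {x : A → Fin m → ℝ}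
    {v : A → Fin m → BranchVec} {s : A → Fin m → ℕ → Fin m} (hx : Measurable x)
    (hv : Measurable v) (hs : Measurable s) :
    Measurable fun a => nextPool (x a) (v a) (s a) := by
  have heval : Measurable fun p : (Fin m → ℝ) × Fin m => p.1 p.2 :=
    measurable_from_prod_countable_left fun i => measurable_pi_apply i
  refine measurable_pi_lambda _ fun i => ?_
  refine measurable_step.comp (f := fun a => (v a i, fun r => x a (s a i r))) ?_
  refine ((measurable_pi_apply i).comp hv).prodMk (measurable_pi_lambda _ fun r => ?_)
  exact heval.comp (hx.prodMk ((measurable_pi_apply r).comp ((measurable_pi_apply i).comp hs)))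

lemma measurable_poolFun {A : Type*} [MeasurableSpace A] {x : A → Fin m → ℝ}
    {v : A → ℕ → Fin m → BranchVec} {s : A → ℕ → Fin m → ℕ → Fin m} (hx : Measurable x)
    (hv : Measurable v) (hs : Measurable s) (j : ℕ) :
    Measurable fun a => poolFun j (x a) (v a) (s a) := by
  induction j with
  | zero => exact hx
  | succ j ih =>
    exact measurable_nextPool ih ((measurable_pi_apply j).comp hv) ((measurable_pi_apply j).comp hs)

/-- Prepending a term to a sequence. -/
def seqCons {X : Type*} (a : X) (z : ℕ → X) : ℕ → X := fun n => Nat.casesOn n a z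

lemma measurable_seqCons {A X : Type*} [MeasurableSpace A] [MeasurableSpace X] {f : A → X}
    {g : A → ℕ → X} (hf : Measurable f) (hg : Measurable g) :
    Measurable fun a => seqCons (f a) (g a) := by
  refine measurable_pi_lambda _ fun n => ?_
  cases n with
  | zero => exact hf
  | succ n => exact (measurable_pi_apply n).comp hg

lemma lintegral_infinitePi_seqCons {X : Type*} [MeasurableSpace X] (ν : Measure X)
    [IsProbabilityMeasure ν] {f : (ℕ → X) → ℝ≥0∞} (hf : Measurable f) :
    ∫⁻ z, f z ∂(Measure.infinitePi fun _ : ℕ => ν) =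
      ∫⁻ a, ∫⁻ z, f (seqCons a z) ∂(Measure.infinitePi fun _ : ℕ => ν) ∂ν := by
  have hm : Measurable fun p : X × (ℕ → X) => seqCons p.1 p.2 :=
    measurable_seqCons measurable_fst measurable_snd
  let e : ℕ ≃ Option ℕ :=
    { toFun := fun n => Nat.casesOn n none some
      invFun := fun o => o.elim 0 Nat.succ
      left_inv := fun n => by cases n <;> rfl
      right_inv := fun o => by cases o <;> rfl }
  have he : (fun (p : X × (ℕ → X)) (i : ℕ) => (e i).elim p.1 p.2) =
      fun p => seqCons p.1 p.2 := by
    ext p i; cases i <;> rfl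
  have h := map_equiv_optionElim_prod_infinitePi ν e
  rw [he] at h
  conv_lhs => rw [← h]
  rw [lintegral_map hf hm, lintegral_prod (fun p => f (seqCons p.1 p.2)) (hf.comp hm).aemeasurable]

/-- Splitting off the first terms of two independent i.i.d. sequences. -/
lemma lintegral_lintegral_infinitePi_seqCons {X Y : Type*} [MeasurableSpace X] [MeasurableSpace Y]
    (ν : Measure X) [IsProbabilityMeasure ν] (κ : Measure Y) [IsProbabilityMeasure κ]
    {f : (ℕ → X) × (ℕ → Y) → ℝ≥0∞} (hf : Measurable f) :
    ∫⁻ v, ∫⁻ s, f (v, s) ∂(Measure.infinitePi fun _ : ℕ => κ) ∂(Measure.infinitePi fun _ : ℕ => ν) =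
      ∫⁻ a, ∫⁻ b, ∫⁻ v, ∫⁻ s, f (seqCons a v, seqCons b s) ∂(Measure.infinitePi fun _ : ℕ => κ)
        ∂(Measure.infinitePi fun _ : ℕ => ν) ∂κ ∂ν := by
  rw [lintegral_infinitePi_seqCons ν hf.lintegral_prod_right']
  refine lintegral_congr fun a => ?_
  have h (v : ℕ → X) : ∫⁻ s, f (seqCons a v, s) ∂(Measure.infinitePi fun _ : ℕ => κ) =
      ∫⁻ b, ∫⁻ s, f (seqCons a v, seqCons b s) ∂(Measure.infinitePi fun _ : ℕ => κ) ∂κ :=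
    lintegral_infinitePi_seqCons κ (f := fun s => f (seqCons a v, s))
      (hf.comp (measurable_const.prodMk measurable_id))
  simp only [h]
  refine lintegral_lintegral_swap (Measurable.aemeasurable (Measurable.lintegral_prod_right'
    (f := fun p : ((ℕ → X) × Y) × (ℕ → Y) => f (seqCons a p.1.1, seqCons p.1.2 p.2)) ?_))
  exact hf.comp ((measurable_seqCons measurable_const measurable_fst.fst).prodMk
    (measurable_seqCons measurable_fst.snd measurable_snd))

instance instIsProbabilityMeasureUniformOnFin [NeZero m] :
    IsProbabilityMeasure (uniformOn (Set.univ : Set (Fin m))) :=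
  isProbabilityMeasure_uniformOn Set.finite_univ Set.univ_nonempty

variable (μ : Measure BranchVec)

/-- The law of the branching vectors used at one level. -/
abbrev levelV (m : ℕ) : Measure (Fin m → BranchVec) := Measure.infinitePi fun _ : Fin m => μ

/-- The law of the positions drawn at one level. -/
abbrev levelI (m : ℕ) : Measure (Fin m → ℕ → Fin m) :=
  Measure.infinitePi fun _ : Fin m => Measure.infinitePi fun _ : ℕ => uniformOn Set.univ

/-- Given the pool `x`, the members of the next pool are i.i.d. with law
`smoothing μ (empirical x)`. -/
lemma map_nextPool [IsProbabilityMeasure μ] [NeZero m] (x : Fin m → ℝ) :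
    ((levelV μ m).prod (levelI m)).map (fun p => nextPool x p.1 p.2) =
      Measure.pi fun _ : Fin m => smoothing μ (empirical x) := by
  have hx : Measurable x := measurable_of_finite x
  have hs := measurable_step_comp hx
  have := isProbabilityMeasure_empirical (Nat.one_le_iff_ne_zero.2 (NeZero.ne m)) x
  have hlaw := map_step_comp (μ := μ) (uniformOn Set.univ) hx
  rw [map_uniformOn_univ] at hlaw
  -- A pair of families is regrouped into a family of pairs, one for each member of the next pool.
  have hpi := measurePreserving_arrowProdEquivProdArrow BranchVec (ℕ → Fin m) (Fin m)
    (fun _ => μ) (fun _ => Measure.infinitePi fun _ : ℕ => uniformOn Set.univ)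
  rw [levelV, levelI, Measure.infinitePi_eq_pi, Measure.infinitePi_eq_pi, ← hpi.map_eq,
    Measure.map_map (measurable_nextPool measurable_const measurable_fst measurable_snd)
      hpi.measurable, ← hlaw]
  have : SigmaFinite ((μ.prod (Measure.infinitePi fun _ : ℕ => uniformOn
      (Set.univ : Set (Fin m)))).map fun s => step s.1 fun r => x (s.2 r)) := by
    rw [hlaw]; infer_instance
  rw [← Measure.pi_map_pi fun _ => hs.aemeasurable]
  rfl

/-- The expected distance after `j` further levels, started from the pool `x` compared with the
law of `R^{(n)}`. -/
lemma lintegral_cdfDist_poolFun_le [IsProbabilityMeasure μ] [NeZero m] {D : ℝ≥0∞}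
    (hD : ∀ k, ∫⁻ y, cdfDist (empirical y) (lawR μ k) ∂(Measure.pi fun _ : Fin m => lawR μ k) ≤ D)
    (j n : ℕ) (x : Fin m → ℝ) :
    ∫⁻ v, ∫⁻ s, cdfDist (empirical (poolFun j x v s)) (lawR μ (n + j))
        ∂(Measure.infinitePi fun _ : ℕ => levelI m) ∂(Measure.infinitePi fun _ : ℕ => levelV μ m) ≤
      lrho μ 1 ^ j * cdfDist (empirical x) (lawR μ n) +
        ∑ i ∈ Finset.range j, lrho μ 1 ^ i * D := by
  have hm : 1 ≤ m := Nat.one_le_iff_ne_zero.2 (NeZero.ne m)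
  -- The first level replaces `x` by a random pool and `n` by `n + 1`, hence both vary in the
  -- induction.
  induction j generalizing n x with
  | zero => simp [poolFun]
  | succ j ih =>
    have hW := measurable_cdfDist_empirical (m := m) (lawR μ (n + (j + 1)))
    have hG : Measurable fun p : (ℕ → Fin m → BranchVec) × (ℕ → Fin m → ℕ → Fin m) =>
        cdfDist (empirical (poolFun (j + 1) x p.1 p.2)) (lawR μ (n + (j + 1))) :=
      hW.comp (measurable_poolFun measurable_const measurable_fst measurable_snd _)
    calc ∫⁻ v, ∫⁻ s, cdfDist (empirical (poolFun (j + 1) x v s)) (lawR μ (n + (j + 1)))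
          ∂(Measure.infinitePi fun _ : ℕ => levelI m)
          ∂(Measure.infinitePi fun _ : ℕ => levelV μ m)
        = ∫⁻ v₀, ∫⁻ s₀, ∫⁻ v, ∫⁻ s,
            cdfDist (empirical (poolFun j (nextPool x v₀ s₀) v s)) (lawR μ (n + (j + 1)))
            ∂(Measure.infinitePi fun _ : ℕ => levelI m)
            ∂(Measure.infinitePi fun _ : ℕ => levelV μ m) ∂(levelI m) ∂(levelV μ m) := by
          rw [lintegral_lintegral_infinitePi_seqCons (levelV μ m) (levelI m) hG]
          simp only [poolFun_succ']
          rfl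
      _ ≤ ∫⁻ v₀, ∫⁻ s₀, (lrho μ 1 ^ j *
            cdfDist (empirical (nextPool x v₀ s₀)) (lawR μ (n + 1)) +
              ∑ i ∈ Finset.range j, lrho μ 1 ^ i * D) ∂(levelI m) ∂(levelV μ m) := by
          refine lintegral_mono fun v₀ => lintegral_mono fun s₀ => ?_
          have := ih (n + 1) (nextPool x v₀ s₀)
          rwa [show n + 1 + j = n + (j + 1) by ring] at this
      _ = lrho μ 1 ^ j * ∫⁻ y, cdfDist (empirical y) (lawR μ (n + 1))
            ∂(Measure.pi fun _ : Fin m => smoothing μ (empirical x)) +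
              ∑ i ∈ Finset.range j, lrho μ 1 ^ i * D := by
          have hW' := measurable_cdfDist_empirical (m := m) (lawR μ (n + 1))
          have hN : Measurable fun p : (Fin m → BranchVec) × (Fin m → ℕ → Fin m) =>
              nextPool x p.1 p.2 :=
            measurable_nextPool measurable_const measurable_fst measurable_snd
          rw [← lintegral_prod (fun p : (Fin m → BranchVec) × (Fin m → ℕ → Fin m) =>
              lrho μ 1 ^ j * cdfDist (empirical (nextPool x p.1 p.2)) (lawR μ (n + 1)) +
              ∑ i ∈ Finset.range j, lrho μ 1 ^ i * D)
              (((hW'.comp hN).const_mul _).add_const _).aemeasurable,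
            lintegral_add_right _ measurable_const, lintegral_const_mul _
              (f := fun p : (Fin m → BranchVec) × (Fin m → ℕ → Fin m) =>
                cdfDist (empirical (nextPool x p.1 p.2)) (lawR μ (n + 1))) (hW'.comp hN),
            lintegral_const, measure_univ, mul_one, ← map_nextPool, lintegral_map hW' hN]
      _ ≤ lrho μ 1 ^ j * (lrho μ 1 * cdfDist (empirical x) (lawR μ n) + D) +
              ∑ i ∈ Finset.range j, lrho μ 1 ^ i * D := by
          -- The one-level estimate applies because `lawR μ (n + 1)` is `smoothing μ (lawR μ n)` by
          -- definition.
          have h1 : ∫⁻ y, cdfDist (empirical y) (lawR μ (n + 1))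
              ∂(Measure.pi fun _ : Fin m => smoothing μ (empirical x)) ≤ _ :=
            lintegral_cdfDist_smoothing_le hm (lawR μ n) x
          exact add_le_add_left (mul_le_mul_right (h1.trans (add_le_add_right (hD (n + 1)) _)) _) _
      _ = _ := by
          rw [Finset.sum_range_succ, pow_succ]
          ring

variable {μ}

lemma IsAlgorithmInput.map_Q₀ [IsProbabilityMeasure μ] [MeasurableSpace Ω] {P : Measure Ω}
    {Q₀ : Fin m → Ω → ℝ}
    {V : ℕ → Fin m → Ω → BranchVec} {I : ℕ → Fin m → ℕ → Ω → Fin m}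
    (h : IsAlgorithmInput μ P Q₀ V I) :
    P.map (fun ω i => Q₀ i ω) = Measure.pi fun _ : Fin m => lawR μ 0 := by
  rw [h.indep_Q₀.map_fun_eq_infinitePi_map h.measurable_Q₀]
  simp only [h.law_Q₀]
  exact Measure.infinitePi_eq_pi (μ := fun _ : Fin m => lawR μ 0)

lemma IsAlgorithmInput.map_V [IsProbabilityMeasure μ] [MeasurableSpace Ω] {P : Measure Ω}
    {Q₀ : Fin m → Ω → ℝ}
    {V : ℕ → Fin m → Ω → BranchVec} {I : ℕ → Fin m → ℕ → Ω → Fin m}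
    (h : IsAlgorithmInput μ P Q₀ V I) :
    P.map (fun ω j i => V j i ω) = Measure.infinitePi fun _ : ℕ => levelV μ m := by
  have h1 := h.indep_V.map_fun_eq_infinitePi_map fun p : ℕ × Fin m => h.measurable_V p.1 p.2
  simp only [h.law_V] at h1
  have hV : Measurable fun ω (p : ℕ × Fin m) => V p.1 p.2 ω :=
    measurable_pi_lambda _ fun p => h.measurable_V p.1 p.2
  rw [levelV, ← Measure.infinitePi_map_curry (fun (_ : ℕ) (_ : Fin m) => μ), ← h1,
    Measure.map_map (MeasurableEquiv.measurable _) hV]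
  rfl

lemma IsAlgorithmInput.map_I [NeZero m] [MeasurableSpace Ω] {P : Measure Ω} {Q₀ : Fin m → Ω → ℝ}
    {V : ℕ → Fin m → Ω → BranchVec} {I : ℕ → Fin m → ℕ → Ω → Fin m}
    (h : IsAlgorithmInput μ P Q₀ V I) :
    P.map (fun ω j i r => I j i r ω) = Measure.infinitePi fun _ : ℕ => levelI m := by
  have hI : Measurable fun ω (p : ℕ × Fin m × ℕ) => I p.1 p.2.1 p.2.2 ω :=
    measurable_pi_lambda _ fun p => h.measurable_I p.1 p.2.1 p.2.2
  have h1 := h.indep_I.map_fun_eq_infinitePi_map fun p : ℕ × Fin m × ℕ =>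
    h.measurable_I p.1 p.2.1 p.2.2
  simp only [h.law_I] at h1
  have hc : Measurable fun (z : ℕ → Fin m × ℕ → Fin m) (j : ℕ) =>
      MeasurableEquiv.curry (Fin m) ℕ (Fin m) (z j) :=
    measurable_pi_lambda _ fun j => (MeasurableEquiv.measurable _).comp (measurable_pi_apply j)
  rw [levelI, ← Measure.infinitePi_map_curry (fun (_ : Fin m) (_ : ℕ) => uniformOn Set.univ),
    ← Measure.infinitePi_map_pi _ fun _ => MeasurableEquiv.measurable _,
    ← Measure.infinitePi_map_curry (fun (_ : ℕ) (_ : Fin m × ℕ) => uniformOn Set.univ), ← h1,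
    Measure.map_map (MeasurableEquiv.measurable _) hI,
    Measure.map_map hc ((MeasurableEquiv.measurable _).comp hI)]
  rfl

/-- Transfers the estimate from the given probability space to the product space, where levels can
be integrated one at a time. -/
lemma IsAlgorithmInput.map_input [IsProbabilityMeasure μ] [NeZero m] [MeasurableSpace Ω]
    {P : Measure Ω}
    [IsProbabilityMeasure P] {Q₀ : Fin m → Ω → ℝ}
    {V : ℕ → Fin m → Ω → BranchVec} {I : ℕ → Fin m → ℕ → Ω → Fin m}
    (h : IsAlgorithmInput μ P Q₀ V I) :
    P.map (fun ω => ((fun i => Q₀ i ω), (fun j i => V j i ω), fun j i r => I j i r ω)) =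
      (Measure.pi fun _ : Fin m => lawR μ 0).prod
        ((Measure.infinitePi fun _ : ℕ => levelV μ m).prod
          (Measure.infinitePi fun _ : ℕ => levelI m)) := by
  have hQ : Measurable fun ω i => Q₀ i ω := measurable_pi_lambda _ h.measurable_Q₀
  have hV : Measurable fun ω j i => V j i ω :=
    measurable_pi_lambda _ fun j => measurable_pi_lambda _ fun i => h.measurable_V j i
  have hI : Measurable fun ω j i r => I j i r ω :=
    measurable_pi_lambda _ fun j => measurable_pi_lambda _ fun i =>
      measurable_pi_lambda _ fun r => h.measurable_I j i r
  have cV : Measurable fun (z : ℕ × Fin m → BranchVec) j i => z (j, i) := by fun_prop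
  have cI : Measurable fun (z : ℕ × Fin m × ℕ → Fin m) j i r => z (j, i, r) := by fun_prop
  have i1 : IndepFun (fun ω j i => V j i ω) (fun ω j i r => I j i r ω) P :=
    h.indep_V_I.comp cV cI
  have i2 : IndepFun (fun ω i => Q₀ i ω)
      (fun ω => ((fun j i => V j i ω), fun j i r => I j i r ω)) P :=
    h.indep_Q₀_V_I.comp measurable_id (cV.prodMap cI)
  rw [← h.map_Q₀, ← h.map_V, ← h.map_I,
    ← (indepFun_iff_map_prod_eq_prod_map_map hV.aemeasurable hI.aemeasurable).1 i1,
    ← (indepFun_iff_map_prod_eq_prod_map_map hQ.aemeasurable (hV.prodMk hI).aemeasurable).1 i2]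

/-- The bound for the algorithm in terms of a uniform bound for empirical measures of i.i.d.
samples. -/
lemma IsAlgorithmInput.lintegral_cdfDist_pool_le [IsProbabilityMeasure μ] [NeZero m] [MeasurableSpace Ω]
    {P : Measure Ω}
    [IsProbabilityMeasure P] {Q₀ : Fin m → Ω → ℝ}
    {V : ℕ → Fin m → Ω → BranchVec} {I : ℕ → Fin m → ℕ → Ω → Fin m}
    (h : IsAlgorithmInput μ P Q₀ V I) {D : ℝ≥0∞}
    (hD : ∀ k, ∫⁻ y, cdfDist (empirical y) (lawR μ k) ∂(Measure.pi fun _ : Fin m => lawR μ k) ≤ D)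
    (k : ℕ) :
    ∫⁻ ω, cdfDist (empirical (pool Q₀ V I k ω)) (lawR μ k) ∂P ≤
      ∑ i ∈ Finset.range (k + 1), lrho μ 1 ^ i * D := by
  have hin : Measurable fun ω =>
      ((fun i => Q₀ i ω), (fun j i => V j i ω), fun j i r => I j i r ω) :=
    (measurable_pi_lambda _ h.measurable_Q₀).prodMk ((measurable_pi_lambda _ fun j =>
      measurable_pi_lambda _ fun i => h.measurable_V j i).prodMk (measurable_pi_lambda _ fun j =>
        measurable_pi_lambda _ fun i => measurable_pi_lambda _ fun r => h.measurable_I j i r))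
  have hW := measurable_cdfDist_empirical (m := m) (lawR μ k)
  have hG : Measurable fun p : (Fin m → ℝ) × (ℕ → Fin m → BranchVec) ×
      (ℕ → Fin m → ℕ → Fin m) => cdfDist (empirical (poolFun k p.1 p.2.1 p.2.2)) (lawR μ k) :=
    hW.comp (measurable_poolFun measurable_fst measurable_snd.fst measurable_snd.snd k)
  simp only [pool_eq_poolFun]
  rw [← lintegral_map (f := fun p : (Fin m → ℝ) × (ℕ → Fin m → BranchVec) ×
      (ℕ → Fin m → ℕ → Fin m) => cdfDist (empirical (poolFun k p.1 p.2.1 p.2.2)) (lawR μ k))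
      hG hin, h.map_input, lintegral_prod _ hG.aemeasurable]
  calc _ ≤ ∫⁻ x, (lrho μ 1 ^ k * cdfDist (empirical x) (lawR μ 0) +
        ∑ i ∈ Finset.range k, lrho μ 1 ^ i * D) ∂(Measure.pi fun _ : Fin m => lawR μ 0) := by
        refine lintegral_mono fun x => ?_
        rw [lintegral_prod (fun z : (ℕ → Fin m → BranchVec) × (ℕ → Fin m → ℕ → Fin m) =>
          cdfDist (empirical (poolFun k x z.1 z.2)) (lawR μ k))
          (hG.comp (measurable_const.prodMk measurable_id)).aemeasurable]
        have := lintegral_cdfDist_poolFun_le μ hD k 0 x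
        rwa [zero_add] at this
    -- The initial pool is itself an i.i.d. sample from `F_0`, so its error is again at most `D`;
    -- this is the summand `i = k`.
    _ ≤ lrho μ 1 ^ k * D + ∑ i ∈ Finset.range k, lrho μ 1 ^ i * D := by
        rw [lintegral_add_right _ measurable_const, lintegral_const, measure_univ, mul_one,
          lintegral_const_mul _ (measurable_cdfDist_empirical _)]
        gcongr
        exact hD 0
    _ = _ := by rw [Finset.sum_range_succ, add_comm]

end Pool

end IterBootstrap

end

/-! ### The rate for the algorithm -/

theorem theoremT (μ : Measure IterBootstrap.BranchVec) [IsProbabilityMeasure μ]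
    (β : ℝ) (hβ : 1 < β) (hμ : IterBootstrap.MomentConditions μ β)
    (α : ℝ) (hα1 : 1 < α) (hα2 : α < 2) (hαβ : α ≤ β) :
    ∃ K : ℝ, 0 ≤ K ∧
      ∀ (Ω' : Type*) [MeasurableSpace Ω'] (P' : Measure Ω') [IsProbabilityMeasure P']
        (V' : List ℕ → Ω' → IterBootstrap.BranchVec)
        (_ : IterBootstrap.IsBranchingFamily μ P' V')
        (m : ℕ) (_ : 1 ≤ m)
        (Ω : Type*) [MeasurableSpace Ω] (P : Measure Ω) [IsProbabilityMeasure P]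
        (Q₀ : Fin m → Ω → ℝ) (V : ℕ → Fin m → Ω → IterBootstrap.BranchVec)
        (I : ℕ → Fin m → ℕ → Ω → Fin m)
        (_ : IterBootstrap.IsAlgorithmInput μ P Q₀ V I) (k : ℕ),
        ∫⁻ ω, IterBootstrap.d1 (IterBootstrap.empirical (IterBootstrap.pool Q₀ V I k ω))
            (P'.map (IterBootstrap.R V' k)) ∂P
          ≤ ENNReal.ofReal (K * (m : ℝ) ^ (-1 + 1 / α) *
              ∑ i ∈ Finset.range (k + 1), IterBootstrap.rho μ 1 ^ i) := by
  open IterBootstrap in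
  obtain ⟨M, hM0, hM⟩ := hμ.exists_moment_bound hβ hα1 hα2 hαβ
  have hK := rateConst_nonneg hα1 hα2 hM0
  -- The constant is fixed before `k`, `m` and the probability spaces appear, since `M` bounds the
  -- moments of all `lawR μ k`.
  refine ⟨rateConst α M, hK, ?_⟩
  intro Ω' _ P' _ V' hV' m hm Ω _ P _ Q₀ V I hin k
  have : NeZero m := ⟨by lia⟩
  have hmα : (0 : ℝ) ≤ (m : ℝ) ^ (-1 + 1 / α) := Real.rpow_nonneg (Nat.cast_nonneg m) _
  rw [hV'.map_R k]
  calc ∫⁻ ω, d1 (empirical (pool Q₀ V I k ω)) (lawR μ k) ∂P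
      ≤ ∫⁻ ω, cdfDist (empirical (pool Q₀ V I k ω)) (lawR μ k) ∂P := by
        refine lintegral_mono fun ω => ?_
        have := isProbabilityMeasure_empirical hm (pool Q₀ V I k ω)
        exact d1_le_cdfDist _ _
    _ ≤ ∑ i ∈ Finset.range (k + 1),
          lrho μ 1 ^ i * ENNReal.ofReal (rateConst α M * (m : ℝ) ^ (-1 + 1 / α)) :=
        hin.lintegral_cdfDist_pool_le
          (fun k => lintegral_cdfDist_empirical_le hm (lawR μ k) hα1 hα2 hM0 (hM k)) k
    _ = _ := by
        rw [hμ.lrho_eq le_rfl hβ.le, ← Finset.sum_mul, mul_comm,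
          ENNReal.ofReal_mul (mul_nonneg hK hmα),
          ENNReal.ofReal_sum_of_nonneg fun i _ => pow_nonneg rho_nonneg i]
        simp only [ENNReal.ofReal_pow rho_nonneg]
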